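/- Let $\mathbb F=\mathbb Z/2\mathbb Z$ and let $C$ be a free, finitely generated, Maslov-graded, $\mathbb Z\oplus\mathbb Z$-filtered chain complex over $\mathbb F[U,U^{-1}]$, with filtrations $(w,A)$, such that the differential $\partial$ lowers the grading by one and multiplication by $U$ lowers both filtrations by one and the grading by two. A \emph{filtered basis} of $C$ is a homogeneous $\mathbb F[U,U^{-1}]$-basis inducing a basis of the associated graded object; each basis element $x$ then has a level $(w(x),A(x))$, and $U^kx$ has level $(w(x)-k,A(x)-k)$. $C$ is assumed to have a filtered basis. Assume moreover that (1) exchanging the two filtrations gives a complex filtered chain homotopy equivalent to $C$; (2) the homology of every column of $C$ has rank one over $\mathbb F$; (3) $H_*(C)\cong\mathbb F[U,U^{-1}]$. For instance, $C=CFK^\infty(K)$ for a knot $K\subset S^3$. For a convex set $S\subset\mathbb Z\oplus\mathbb Z$ let $C\{S\}$ be the corresponding subquotient complex, and let $$\tau=\min\{s : H_*(C\{i=0,\,j\le s\})\to H_*(C\{i=0\})\text{ is non-trivial}\}.$$ Say that $\varepsilon(C)=1$ if the map $C\{i=0\}\to C\{\min(i,j-\tau)=0\}$ (quotient by $C\{i=0,j<\tau\}$,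 then inclusion) is trivial on homology. Let $\varepsilon(C)=1$. Put $S(s)=\{\min(i,j-\tau)=0,\ i\le s\}$ and, for $n\ge1$ and $s \geq 0$, $$S(a_1,\dots,a_n,s)=S(a_1,\dots,a_n)\cup\begin{cases}\{j=\tau-a^n_{\rm even},\ a^n_{\rm odd}<i\le a^n_{\rm odd}+s\}& n\text{ even},\\ \{i=a^n_{\rm odd},\ \tau-a^n_{\rm even}-s\le j<\tau-a^n_{\rm even}\}& n\text{ odd},\end{cases}$$ where $a^n_{\rm odd}$ and $a^n_{\rm even}$ are the sums of the $a_k$, $1\le k\le n$, with $k$ odd, respectively even. Let $H_{a_1,\dots,a_n,s}$ be the map induced on homology by $C\{i=0\}\to C\{S(a_1,\dots,a_n,s)\}$ (quotient by $C\{i=0,j<\tau\}$, then inclusion). Define inductively, for $n\ge0$, $a_{n+1}$ as the least $s\ge0$ such that $H_{a_1,\dots,a_n,s}$ is trivial if $n$ is even, and non-trivial if $n$ is odd; it is undefined if there is no such $s$. Write $\boldsymbol a^+(C)=(a_1,\dots,a_n)$, $n\ge1$, if $a_1,\dots,a_n$ are defined and $a_{n+1}$ is not. Given a filtered basis, there is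 an arrow from $x$ to $U^ky$ ($x,y$ basis elements) if $U^ky$ appears in $\partial x$. It is horizontal if it preserves $A$, with length the drop in $w$, and vertical if it preserves $w$, with length the drop in $A$. \textbf{Proposition.} If $\boldsymbol a^+(C)=(a_1,\dots,a_n)$, then $C$ has a filtered basis over $\mathbb F[U,U^{-1}]$ with distinct basis elements $x_0,\dots,x_n$ such that (1) for $i$ odd, $1\le i\le n$, there is a horizontal arrow of length $a_i$ from $x_i$ to $x_{i-1}$; (2) for $i$ even, $2\le i\le n$, there is a vertical arrow of length $a_i$ from $x_{i-1}$ to $x_i$; (3) up to multiplication by powers of $U$, there are no other horizontal or vertical arrows to or from $x_0,\dots,x_{n-1}$; (4) if $n$ is odd, there are no other horizontal arrows to or from $x_n$; if $n$ is even, there are no other vertical arrows to or from $x_n$. -/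

import Mathlib

open scoped LaurentPolynomial

/-- The ground ring `𝔽[U, U⁻¹]` with `𝔽 = ℤ/2ℤ`; the monomial `U ^ k` is `LaurentPolynomial.T k`. -/
abbrev LaurentF2 : Type := (ZMod 2)[T;T⁻¹]

/-- Raw data on an `𝔽[U, U⁻¹]`-module: a differential, two increasing filtrations `W` (the
`w`-filtration) and `A` (the Alexander filtration) and a Maslov grading `M`.  Since `𝔽 = ℤ/2ℤ`,
the `𝔽`-subspaces are exactly the additive subgroups. -/
structure BifilteredData (C : Type*) [AddCommGroup C] [Module LaurentF2 C] where
  d : C →ₗ[LaurentF2] C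
  W : ℤ → AddSubgroup C
  A : ℤ → AddSubgroup C
  M : ℤ → AddSubgroup C

/-- `b` is a (homogeneous) filtered basis, the `l`-th element having filtration level
`(w l, al l)` and Maslov grading `m l`.  As `U` shifts both filtrations by `-1` and the grading
by `-2`, the element `U ^ k • b l` has level `(w l - k, al l - k)` and grading `m l - 2 * k`;
these elements induce bases of all filtration pieces, hence of the associated graded object. -/
structure BifilteredData.IsFilteredBasis {C : Type*} [AddCommGroup C] [Module LaurentF2 C]
    (X : BifilteredData C) {ι : Type*} (b : Module.Basis ι LaurentF2 C) (w al m : ι → ℤ) :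
    Prop where
  W_eq : ∀ i : ℤ, X.W i = AddSubgroup.closure
    {x | ∃ (l : ι) (k : ℤ), w l - k ≤ i ∧ x = (LaurentPolynomial.T k : LaurentF2) • b l}
  A_eq : ∀ j : ℤ, X.A j = AddSubgroup.closure
    {x | ∃ (l : ι) (k : ℤ), al l - k ≤ j ∧ x = (LaurentPolynomial.T k : LaurentF2) • b l}
  M_eq : ∀ n : ℤ, X.M n = AddSubgroup.closure
    {x | ∃ (l : ι) (k : ℤ), m l - 2 * k = n ∧ x = (LaurentPolynomial.T k : LaurentF2) • b l}

/-- A `ℤ ⊕ ℤ`-filtered, graded, free, finitely generated chain complex over `𝔽[U, U⁻¹]`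
(not necessarily reduced). -/
structure BifilteredComplex (C : Type*) [AddCommGroup C] [Module LaurentF2 C] extends
    BifilteredData C where
  d_d : ∀ x, d (d x) = 0
  d_W : ∀ i, ∀ x ∈ W i, d x ∈ W i
  d_A : ∀ j, ∀ x ∈ A j, d x ∈ A j
  d_M : ∀ n, ∀ x ∈ M n, d x ∈ M (n - 1)
  exists_filteredBasis : ∃ (N : ℕ) (b : Module.Basis (Fin N) LaurentF2 C) (w al m : Fin N → ℤ),
    toBifilteredData.IsFilteredBasis b w al m

namespace BifilteredComplex

variable {C : Type*} [AddCommGroup C] [Module LaurentF2 C] (X : BifilteredComplex C)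

/-- The complex obtained by reversing the roles of the two filtrations. -/
def swap : BifilteredComplex C where
  d := X.d
  W := X.A
  A := X.W
  M := X.M
  d_d := X.d_d
  d_W := X.d_A
  d_A := X.d_W
  d_M := X.d_M
  exists_filteredBasis := by
    obtain ⟨N, b, w, al, m, h⟩ := X.exists_filteredBasis
    exact ⟨N, b, al, w, m, ⟨h.A_eq, h.W_eq, h.M_eq⟩⟩

/-- A linear map respecting both filtrations. -/
def IsFilteredMap {C' : Type*} [AddCommGroup C'] [Module LaurentF2 C']
    (X : BifilteredComplex C) (Y : BifilteredComplex C') (f : C →ₗ[LaurentF2] C') : Prop :=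
  (∀ i, ∀ x ∈ X.W i, f x ∈ Y.W i) ∧ (∀ j, ∀ x ∈ X.A j, f x ∈ Y.A j)

/-- Filtered chain homotopy equivalence over `𝔽[U, U⁻¹]`. (The maps are not asked to be
homogeneous for the Maslov grading; this relation occurs only in a hypothesis.) -/
def FilteredHomotopic {C' : Type*} [AddCommGroup C'] [Module LaurentF2 C']
    (X : BifilteredComplex C) (Y : BifilteredComplex C') : Prop :=
  ∃ (f : C →ₗ[LaurentF2] C') (g : C' →ₗ[LaurentF2] C)
    (h : C →ₗ[LaurentF2] C) (h' : C' →ₗ[LaurentF2] C'),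
    IsFilteredMap X Y f ∧ IsFilteredMap Y X g ∧ IsFilteredMap X X h ∧ IsFilteredMap Y Y h' ∧
    (∀ x, f (X.d x) = Y.d (f x)) ∧ (∀ y, g (Y.d y) = X.d (g y)) ∧
    (∀ x, g (f x) - x = X.d (h x) + h (X.d x)) ∧
    (∀ y, f (g y) - y = Y.d (h' y) + h' (Y.d y))

/-- The elements supported in filtration levels in `D`.  For a lower set `D` this is the
subcomplex `C{D}`. -/
def sub (D : Set (ℤ × ℤ)) : AddSubgroup C := ⨆ p ∈ D, X.W p.1 ⊓ X.A p.2

theorem sub_mono {D D' : Set (ℤ × ℤ)} (h : D ⊆ D') : X.sub D ≤ X.sub D' :=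
  biSup_mono h

theorem d_mem_sub (D : Set (ℤ × ℤ)) : X.sub D ≤ (X.sub D).comap X.d.toAddMonoidHom := by
  refine iSup₂_le fun p hp x hx => ?_
  have h : X.W p.1 ⊓ X.A p.2 ≤ X.sub D := le_biSup (fun p : ℤ × ℤ => X.W p.1 ⊓ X.A p.2) hp
  exact h ⟨X.d_W _ _ hx.1, X.d_A _ _ hx.2⟩

/-- The levels in `S` or below. -/
def down (S : Set (ℤ × ℤ)) : Set (ℤ × ℤ) := {p | ∃ q ∈ S, p ≤ q}

/-- The subquotient `C{S}`, for a convex set `S` of levels: the quotient of the subcomplex of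
levels in `S` or below by the subcomplex of levels strictly below `S`. -/
abbrev SubQuot (S : Set (ℤ × ℤ)) : Type _ :=
  X.sub (down S) ⧸ (X.sub (down S \ S)).addSubgroupOf (X.sub (down S))

/-- The differential of the subcomplex of levels in `D`. -/
noncomputable def dSub (D : Set (ℤ × ℤ)) : X.sub D →+ X.sub D :=
  (X.d.toAddMonoidHom.comp (X.sub D).subtype).codRestrict (X.sub D)
    fun x => X.d_mem_sub D x.2

/-- The differential of `C{S}`. -/
noncomputable def bdry (S : Set (ℤ × ℤ)) : X.SubQuot S →+ X.SubQuot S :=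
  QuotientAddGroup.map _ _ (X.dSub (down S))
    fun x hx => X.d_mem_sub (down S \ S) (x := (x : C)) hx

/-- The homology of `C{S}`. -/
abbrev Homology (S : Set (ℤ × ℤ)) : Type _ :=
  (X.bdry S).ker ⧸ ((X.bdry S).range.addSubgroupOf (X.bdry S).ker)

/-- Condition under which the inclusion of subcomplexes induces a map `C{S} → C{S'}`. -/
def Compat (S S' : Set (ℤ × ℤ)) : Prop := down S ⊆ down S' ∧ down S \ S ⊆ down S' \ S'

/-- The chain map `C{S} → C{S'}` induced by inclusion; it is the quotient by the part of `C{S}`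
outside of `S'`, followed by the inclusion of `C{S ∩ S'}` in `C{S'}`. -/
noncomputable def natMap {S S' : Set (ℤ × ℤ)} (h : Compat S S') : X.SubQuot S →+ X.SubQuot S' :=
  QuotientAddGroup.map _ _ (AddSubgroup.inclusion (X.sub_mono h.1))
    fun _ hx => X.sub_mono h.2 hx

theorem quotientMap_comm {G G' : Type*} [AddCommGroup G] [AddCommGroup G']
    (N : AddSubgroup G) (N' : AddSubgroup G') (δ : G →+ G) (δ' : G' →+ G') (f : G →+ G')
    (h : N ≤ N.comap δ) (h' : N' ≤ N'.comap δ') (hf : N ≤ N'.comap f)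
    (hc : ∀ x, f (δ x) = δ' (f x)) (x : G ⧸ N) :
    QuotientAddGroup.map N N' f hf (QuotientAddGroup.map N N δ h x) =
      QuotientAddGroup.map N' N' δ' h' (QuotientAddGroup.map N N' f hf x) := by
  induction x using QuotientAddGroup.induction_on with
  | H x => exact congrArg (QuotientAddGroup.mk' N') (hc x)

theorem coe_dSub (D : Set (ℤ × ℤ)) (x : X.sub D) : (X.dSub D x : C) = X.d x := rfl

theorem inclusion_dSub {D D' : Set (ℤ × ℤ)} (h : D ⊆ D') (y : X.sub D) :
    AddSubgroup.inclusion (X.sub_mono h) (X.dSub D y) =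
      X.dSub D' (AddSubgroup.inclusion (X.sub_mono h) y) := by
  apply Subtype.ext
  rw [coe_dSub, AddSubgroup.coe_inclusion, AddSubgroup.coe_inclusion, coe_dSub]

theorem natMap_bdry {S S' : Set (ℤ × ℤ)} (h : Compat S S') (x : X.SubQuot S) :
    X.natMap h (X.bdry S x) = X.bdry S' (X.natMap h x) := by
  unfold natMap bdry
  exact quotientMap_comm _ _ _ _ _ _ _ _ (X.inclusion_dSub h.1) x

/-- The restriction of `natMap` to cycles. -/
noncomputable def cycleMap {S S' : Set (ℤ × ℤ)} (h : Compat S S') : (X.bdry S).ker →+ (X.bdry S').ker :=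
  ((X.natMap h).comp (X.bdry S).ker.subtype).codRestrict (X.bdry S').ker fun x => by
    have hx : X.bdry S x = 0 := x.2
    change X.bdry S' (X.natMap h x) = 0
    rw [← X.natMap_bdry h, hx, map_zero]

/-- The map induced on homology by `natMap`. -/
noncomputable def homologyMap {S S' : Set (ℤ × ℤ)} (h : Compat S S') : X.Homology S →+ X.Homology S' :=
  QuotientAddGroup.map _ _ (X.cycleMap h) (by
    rintro ⟨_, hx⟩ ⟨y, rfl⟩
    exact ⟨X.natMap h y, (X.natMap_bdry h y).symm⟩)

/-- The column `{i = i₀}`. -/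
def column (i₀ : ℤ) : Set (ℤ × ℤ) := {p | p.1 = i₀}

/-- The class of complexes to which the invariants `τ`, `ε`, `aₖ` apply: the complex is symmetric
in the two filtrations up to filtered homotopy, the homology of any column has rank one, and the
total homology is `𝔽[U, U⁻¹]`. -/
structure IsKnotLike : Prop where
  symm : FilteredHomotopic X.swap X
  column_rank_one : ∀ i : ℤ, Nonempty (X.Homology (column i) ≃+ ZMod 2)
  total : Nonempty ((LinearMap.ker X.d ⧸
    (LinearMap.range X.d).submoduleOf (LinearMap.ker X.d)) ≃ₗ[LaurentF2] LaurentF2)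

theorem compat_column_le (s : ℤ) : Compat {p : ℤ × ℤ | p.1 = 0 ∧ p.2 ≤ s} (column 0) := by
  constructor
  · rintro p ⟨q, hq, hpq⟩
    exact ⟨q, hq.1, hpq⟩
  · rintro p ⟨⟨q, hq, hpq⟩, hp⟩
    exact ⟨⟨q, hq.1, hpq⟩, fun h => hp ⟨h, hpq.2.trans hq.2⟩⟩

theorem compat_column {τ : ℤ} {S : Set (ℤ × ℤ)} (h : ∀ j, τ ≤ j → ((0 : ℤ), j) ∈ S)
    (h' : ∀ p ∈ S, 0 ≤ p.1) : Compat (column 0) S := by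
  have key : down (column 0) ⊆ down S := by
    rintro p ⟨q, hq, hpq⟩
    exact ⟨(0, max τ p.2), h _ (le_max_left _ _), hpq.1.trans_eq hq, le_max_right _ _⟩
  refine ⟨key, ?_⟩
  rintro p ⟨hd, hp⟩
  refine ⟨key hd, fun hS => hp ?_⟩
  obtain ⟨q, hq, hpq⟩ := hd
  exact le_antisymm (hpq.1.trans_eq hq) (h' p hS)

/-- `τ`: the least `s` such that `C{i = 0, j ≤ s} → C{i = 0}` is non-trivial on homology. -/
noncomputable def tau : ℤ := sInf {s : ℤ | X.homologyMap (compat_column_le s) ≠ 0}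

theorem compat_hook (τ : ℤ) : Compat (column 0) {p : ℤ × ℤ | min p.1 (p.2 - τ) = 0} := by
  refine compat_column (τ := τ) (fun j hj => ?_) (fun p hp => ?_)
  · simp only [Set.mem_ofPred_eq]; omega
  · simp only [Set.mem_ofPred_eq] at hp; omega

/-- `ε = 1`: the map `F : C{i = 0} → C{min(i, j - τ) = 0}` is trivial on homology. -/
def EpsilonEqOne : Prop := X.homologyMap (compat_hook X.tau) = 0

/-- The sum of the `aₖ` with `1 ≤ k ≤ n`, `k` odd. -/
def oddSum (a : ℕ → ℕ) (n : ℕ) : ℕ := ∑ k ∈ (Finset.Icc 1 n).filter (fun k => Odd k), a k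

/-- The sum of the `aₖ` with `1 ≤ k ≤ n`, `k` even. -/
def evenSum (a : ℕ → ℕ) (n : ℕ) : ℕ := ∑ k ∈ (Finset.Icc 1 n).filter (fun k => Even k), a k

/-- `stair τ a n s` is the set `S(a₁, …, aₙ, s)`, which only depends on `a 1, …, a n` and `s`. -/
def stair (τ : ℤ) (a : ℕ → ℕ) : ℕ → ℕ → Set (ℤ × ℤ)
  | 0, s => {p | min p.1 (p.2 - τ) = 0 ∧ p.1 ≤ s}
  | n + 1, s => stair τ a n (a (n + 1)) ∪
      if Even (n + 1) then
        {p | p.2 = τ - evenSum a (n + 1) ∧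
          (oddSum a (n + 1) : ℤ) < p.1 ∧ p.1 ≤ oddSum a (n + 1) + s}
      else
        {p | p.1 = oddSum a (n + 1) ∧
          τ - evenSum a (n + 1) - s ≤ p.2 ∧ p.2 < τ - evenSum a (n + 1)}

theorem compat_stair (τ : ℤ) (a : ℕ → ℕ) (n s : ℕ) : Compat (column 0) (stair τ a n s) := by
  refine compat_column (τ := τ) ?_ ?_
  · induction n generalizing s with
    | zero =>
      intro j hj
      simp only [stair, Set.mem_ofPred_eq]
      omega
    | succ n ih => exact fun j hj => Or.inl (ih _ j hj)
  · induction n generalizing s with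
    | zero =>
      intro p hp
      simp only [stair, Set.mem_ofPred_eq] at hp
      omega
    | succ n ih =>
      rintro p (hp | hp)
      · exact ih _ p hp
      · split_ifs at hp <;> simp only [Set.mem_ofPred_eq] at hp <;> omega

/-- The map `H_{a₁, …, aₙ, s}` induced on homology by `C{i = 0} → C{S(a₁, …, aₙ, s)}`. -/
noncomputable def stairMap (a : ℕ → ℕ) (n s : ℕ) :
    X.Homology (column 0) →+ X.Homology (stair X.tau a n s) :=
  X.homologyMap (compat_stair X.tau a n s)

/-- Given that `aₖ = a k` for `1 ≤ k ≤ n`: the invariant `aₙ₊₁` is defined and equal to `v`. -/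
def IsNext (a : ℕ → ℕ) (n v : ℕ) : Prop :=
  (Even n → IsLeast {s : ℕ | X.stairMap a n s = 0} v) ∧
  (Odd n → IsLeast {s : ℕ | X.stairMap a n s ≠ 0} v)

/-- `𝒂⁺ = (a 1, …, a n)`: the invariants `a₁, …, aₙ` are defined (which presupposes `ε = 1`) and
have these values, and `aₙ₊₁` is not defined. -/
def IsAPlus (n : ℕ) (a : ℕ → ℕ) : Prop :=
  X.EpsilonEqOne ∧ 1 ≤ n ∧ (∀ k < n, X.IsNext a k (a (k + 1))) ∧ ¬ ∃ v, X.IsNext a n v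

/-- There is an arrow from `b p` to `U ^ k • b q`: the latter appears in `∂ (b p)`. -/
def Arrow {ι : Type*} (b : Module.Basis ι LaurentF2 C) (p q : ι) (k : ℤ) : Prop :=
  (b.repr (X.d (b p)) q).coeff k ≠ 0

/-- A horizontal arrow, i.e. one that preserves the Alexander filtration. -/
def HArrow {ι : Type*} (b : Module.Basis ι LaurentF2 C) (al : ι → ℤ) (p q : ι) (k : ℤ) : Prop :=
  X.Arrow b p q k ∧ al q - k = al p

/-- A vertical arrow, i.e. one that preserves the `w`-filtration. -/
def VArrow {ι : Type*} (b : Module.Basis ι LaurentF2 C) (w : ι → ℤ) (p q : ι) (k : ℤ) : Prop :=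
  X.Arrow b p q k ∧ w q - k = w p

/-- The basis `b`, with levels `(w, al)`, is locally simplified for the tuple `(a 1, …, a n)`
with distinguished elements `xᵢ = b (e i)`, `0 ≤ i ≤ n`. -/
structure IsLocallySimplified {ι : Type*} (b : Module.Basis ι LaurentF2 C) (w al : ι → ℤ)
    (n : ℕ) (a : ℕ → ℕ) (e : ℕ → ι) : Prop where
  injOn : Set.InjOn e (Set.Iic n)
  /-- For `i` odd, a horizontal arrow of length `a i` from `xᵢ` to `xᵢ₋₁`. -/
  horz : ∀ i, 1 ≤ i → i ≤ n → Odd i →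
    X.HArrow b al (e i) (e (i - 1)) 0 ∧ w (e i) - w (e (i - 1)) = a i
  /-- For `i` even, a vertical arrow of length `a i` from `xᵢ₋₁` to `xᵢ`. -/
  vert : ∀ i, 1 ≤ i → i ≤ n → Even i →
    X.VArrow b w (e (i - 1)) (e i) 0 ∧ al (e (i - 1)) - al (e i) = a i
  /-- No other horizontal arrow to or from `xᵢ`, for `i < n`, and for `i = n` if `n` is odd. -/
  no_other_horz : ∀ i ≤ n, (i < n ∨ Odd n) → ∀ p q k, (p = e i ∨ q = e i) →
    X.HArrow b al p q k →
      k = 0 ∧ ∃ r, 1 ≤ r ∧ r ≤ n ∧ Odd r ∧ p = e r ∧ q = e (r - 1)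
  /-- No other vertical arrow to or from `xᵢ`, for `i < n`, and for `i = n` if `n` is even. -/
  no_other_vert : ∀ i ≤ n, (i < n ∨ Even n) → ∀ p q k, (p = e i ∨ q = e i) →
    X.VArrow b w p q k →
      k = 0 ∧ ∃ r, 1 ≤ r ∧ r ≤ n ∧ Even r ∧ p = e (r - 1) ∧ q = e r

end BifilteredComplex

/-!
Horizontal and vertical arrows into and out of given basis elements can be read off from the
elements themselves and from their dual coordinate functionals.  The theorem thus reduces to the
construction of two zigzags that are dual to each other.

* A *string* (`IsString`) consists of elements `q 0, y 0, q 1, y 1, …`, which become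
  `x₀, x₁, x₂, x₃, …`, whose levels are the corners of the staircase with steps `a₁, a₂, …`, such
  that modulo lower terms `∂ (y t)` has horizontal part `q t` and vertical part `q (t + 1)`, and
  the horizontal and vertical parts of `∂ (q t)` vanish (for the last `q t`, only the vertical
  part).
* A *costring* (`IsCostring`) consists of functionals `φ 0, ψ 0, φ 1, ψ 1, …` to `ℤ/2ℤ` that vanish
  below the same corners and satisfy the transposed relations.

Let `z` be a homogeneous cycle that generates the homology of `C{i = 0}`.  By the choice of the
last invariant `aₙ`, the class of `z` dies in the homology of `C{S}` for one staircase `S`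
and survives for another one, whose last segment is shorter or longer by one unit.  If it dies,
the relation `z = ∂ Y + (terms strictly below S)`, sorted by the upper right corners of `S`,
telescopes to a string: the `q t` are its partial sums (`exists_isString`).  If it survives, some
functional `Φ` kills all boundaries of `C{S}` and satisfies `Φ z = 1`.  As the annihilator of an
intersection is the sum of the annihilators, `Φ` decomposes along the corners of `S` into a costring
(`exists_isCostring`).  The parity of `n` decides which of the two regions is the longer one;
setting `aₙ₊₁ = 1` makes both constructions uniform in `n`.

Since the corners of each of the two kinds are pairwise incomparable, `q s` and `φ t` pair to zero
for `s ≠ t`, as do `y s` and `ψ t`.  Going along the zigzags, `φ t (q t)` and `ψ t (y t)` all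
equal `φ 0 (q 0) = Φ z = 1`.  After passage to homogeneous parts, the string
and the costring are dual families, and an exchange argument
(`exists_isFilteredBasis_exchange`) makes the string part of a filtered basis in which the costring
gives the corresponding coordinates (`exists_isFilteredBasis_dual`).  The relations of the string
describe the arrows out of the `xᵢ`, and those of the costring the arrows into them.

The invariants are positive: two consecutive ones are defined by opposite conditions, and `a₁ > 0`
by minimality of `τ` (`IsColumnGenerator.stairMap_zero_ne`).
-/

/-! ### Zigzags of elements and of functionals -/

section Functionals

variable {V : Type*} [AddCommGroup V] [Module (ZMod 2) V]

theorem exists_functional_of_notMem {G : AddSubgroup V} {z : V} (hz : z ∉ G) :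
    ∃ φ : V →+ ZMod 2, (∀ x ∈ G, φ x = 0) ∧ φ z = 1 := by
  obtain ⟨f, hf, hG⟩ := Submodule.exists_le_ker_of_notMem
    (p := AddSubgroup.toZModSubmodule 2 G) (v := z) (by simpa using hz)
  refine ⟨f.toAddMonoidHom, fun x hx => ?_, ?_⟩
  · exact hG (show x ∈ AddSubgroup.toZModSubmodule 2 G from hx)
  · exact (Fin.exists_fin_two.1 ⟨f z, rfl⟩).resolve_left (fun h => hf h)

/-- The annihilator of an intersection is the sum of the annihilators. -/
theorem exists_functional_split {G H : AddSubgroup V} {φ : V →+ ZMod 2}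
    (h : ∀ x, x ∈ G → x ∈ H → φ x = 0) :
    ∃ p : V →+ ZMod 2, (∀ x ∈ G, p x = 0) ∧ ∀ x ∈ H, (φ - p) x = 0 := by
  have hφ : φ.toZModLinearMap 2 ∈ (AddSubgroup.toZModSubmodule 2 G ⊓
      AddSubgroup.toZModSubmodule 2 H).dualAnnihilator := by
    rw [Submodule.mem_dualAnnihilator]
    exact fun x hx => h x hx.1 hx.2
  rw [Subspace.dualAnnihilator_inf_eq] at hφ
  obtain ⟨p, hp, q, hq, hpq⟩ := Submodule.mem_sup.1 hφ
  rw [Submodule.mem_dualAnnihilator] at hp hq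
  refine ⟨p.toAddMonoidHom, hp, fun x hx => ?_⟩
  have h1 : p x + q x = φ x := LinearMap.congr_fun hpq x
  have h2 : q x = 0 := hq x hx
  change φ x - p x = 0
  rw [← h1, h2]; simp

end Functionals

section Strings

variable {V : Type*} [AddCommGroup V]

/-- A zigzag of elements in a group with an endomorphism `d` and two filtrations `W`, `A`:
modulo lower terms, `d (y t)` has horizontal part `q t` and vertical part `q (t + 1)`, and the
parts of `d (q t)` vanish.  The element `q t` has level `(α t, β t)` and `y t` has level
`(α (t + 1), β t)`. -/
structure IsString (d : V →+ V) (W A : ℤ → AddSubgroup V) (α β : ℕ → ℤ) (r : ℕ)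
    (q y : ℕ → V) : Prop where
  q_W : ∀ t ≤ r, q t ∈ W (α t)
  q_A : ∀ t ≤ r, q t ∈ A (β t)
  y_W : ∀ t < r, y t ∈ W (α (t + 1))
  y_A : ∀ t < r, y t ∈ A (β t)
  d_q_W : ∀ t ≤ r, d (q t) ∈ W (α t - 1)
  d_q_A : ∀ t < r, d (q t) ∈ A (β t - 1)
  d_y_A : ∀ t < r, d (y t) - q t ∈ A (β t - 1)
  d_y_W : ∀ t < r, d (y t) - q (t + 1) ∈ W (α (t + 1) - 1)

/-- The dual of a string: a zigzag of functionals, `φ t` vanishing on the levels that have a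
smaller first or a smaller second coordinate than `(α t, β t)`, and `ψ t` on those that have so
compared with `(α (t + 1), β t)`. -/
structure IsCostring (d : V →+ V) (W A : ℤ → AddSubgroup V) (α β : ℕ → ℤ) (r : ℕ)
    (φ ψ : ℕ → V →+ ZMod 2) : Prop where
  φ_W : ∀ t ≤ r, ∀ x ∈ W (α t - 1), φ t x = 0
  φ_A : ∀ t ≤ r, ∀ x ∈ A (β t - 1), φ t x = 0
  ψ_W : ∀ t ≤ r, ∀ x ∈ W (α (t + 1) - 1), ψ t x = 0
  ψ_A : ∀ t ≤ r, ∀ x ∈ A (β t - 1), ψ t x = 0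
  φ_d_A : ∀ t ≤ r, ∀ x ∈ A (β t), φ t (d x) = ψ t x
  φ_d_W : ∀ t < r, ∀ x ∈ W (α (t + 1)), φ (t + 1) (d x) = ψ t x
  φ_zero_d : ∀ x ∈ W (α 0), φ 0 (d x) = 0

variable {d : V →+ V} {W A : ℤ → AddSubgroup V} {α β : ℕ → ℤ}

/-- A relation `z + d Y + ∑ d(y t) = u + ∑ v t + e` telescopes to a string: its terms `q t` are the
partial sums, whose `W`-level is read off from the left and whose `A`-level from the right. -/
theorem exists_isString [Module (ZMod 2) V] (hW : Monotone W) (hA : Monotone A)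
    (dW : ∀ i, ∀ x ∈ W i, d x ∈ W i) (dA : ∀ i, ∀ x ∈ A i, d x ∈ A i) (dd : ∀ x, d (d x) = 0)
    (hα : StrictMono α) (hβ : StrictAnti β) (r : ℕ) {z Y u e : V} {y v : ℕ → V}
    (hz : z ∈ W (α 0)) (hdz : d z ∈ W (α 0 - 1)) (hY : Y ∈ W (α 0)) (hu : u ∈ W (α 0 - 1))
    (hyW : ∀ t < r, y t ∈ W (α (t + 1))) (hyA : ∀ t < r, y t ∈ A (β t))
    (hvW : ∀ t < r, v t ∈ W (α (t + 1) - 1)) (hvA : ∀ t < r, v t ∈ A (β t - 1))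
    (heA : e ∈ A (β r))
    (eq : z + d Y + ∑ t ∈ Finset.range r, d (y t) = u + ∑ t ∈ Finset.range r, v t + e) :
    ∃ q : ℕ → V, q 0 = z + d Y + u ∧ IsString d W A α β r q y := by
  have two : ∀ x : V, x + x = 0 := ZModModule.add_self
  have neg : ∀ x : V, -x = x := fun x => neg_eq_of_add_eq_zero_left (two x)
  set q : ℕ → V := fun t => z + d Y + u + ∑ s ∈ Finset.range t, (d (y s) + v s) with hq
  have q0 : q 0 = z + d Y + u := by simp [hq]
  have qs : ∀ t, q (t + 1) = q t + (d (y t) + v t) := fun t => by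
    simp only [hq, Finset.sum_range_succ, add_assoc]
  have qr : q r = e := by
    have h : q r = (z + d Y + ∑ t ∈ Finset.range r, d (y t)) + u + ∑ t ∈ Finset.range r, v t := by
      simp only [hq, Finset.sum_add_distrib]; abel
    rw [h, eq]
    have : u + ∑ t ∈ Finset.range r, v t + e + u + ∑ t ∈ Finset.range r, v t =
      (u + u) + (∑ t ∈ Finset.range r, v t + ∑ t ∈ Finset.range r, v t) + e := by abel
    rw [this, two, two, zero_add, zero_add]
  have hα1 : ∀ t, α t ≤ α (t + 1) - 1 := fun t => by have := hα (Nat.lt_add_one t); omega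
  have hβ1 : ∀ t, β (t + 1) ≤ β t - 1 := fun t => by have := hβ (Nat.lt_add_one t); omega
  have q_W : ∀ t ≤ r, q t ∈ W (α t) := by
    intro t
    induction t with
    | zero =>
      intro _
      rw [q0]
      exact add_mem (add_mem hz (dW _ _ hY)) (hW (by omega) hu)
    | succ t ih =>
      intro ht
      rw [qs]
      refine add_mem (hW (hα.monotone (Nat.le_succ t)) (ih (by omega)))
        (add_mem (dW _ _ (hyW t (by omega))) (hW (by omega) (hvW t (by omega))))
  have q_A : ∀ t ≤ r, q t ∈ A (β t) := by
    intro t ht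
    induction ht using Nat.decreasingInduction with
    | self => rw [qr]; exact heA
    | of_succ t ht ih =>
      have : q t = q (t + 1) + (d (y t) + v t) := by rw [qs, add_assoc, two, add_zero]
      rw [this]
      exact add_mem (hA (by have := hβ1 t; omega) ih)
        (add_mem (dA _ _ (hyA t ht)) (hA (by omega) (hvA t ht)))
  have d_y_A : ∀ t < r, d (y t) - q t ∈ A (β t - 1) := fun t ht => by
    have : d (y t) - q t = q (t + 1) + v t := by
      rw [qs, sub_eq_add_neg, neg, show q t + (d (y t) + v t) + v t = d (y t) + q t + (v t + v t) by
        abel, two, add_zero]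
    rw [this]
    exact add_mem (hA (hβ1 t) (q_A _ ht)) (hvA t ht)
  have d_y_W : ∀ t < r, d (y t) - q (t + 1) ∈ W (α (t + 1) - 1) := fun t ht => by
    have : d (y t) - q (t + 1) = - (q t + v t) := by rw [qs]; abel
    rw [this]
    exact neg_mem (add_mem (hW (hα1 t) (q_W _ ht.le)) (hvW t ht))
  refine ⟨q, q0, q_W, q_A, hyW, hyA, ?_, ?_, d_y_A, d_y_W⟩
  · rintro (_ | t) ht
    · rw [q0, map_add, map_add, dd, add_zero]
      exact add_mem hdz (dW _ _ hu)
    · have := dW _ _ (d_y_W t ht)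
      rwa [map_sub, dd, zero_sub, neg_mem_iff] at this
  · intro t ht
    have := dA _ _ (d_y_A t ht)
    rwa [map_sub, dd, zero_sub, neg_mem_iff] at this

/-- A functional that kills the region strictly below a staircase, and whose composition with `d`
kills the region below it, decomposes into a costring. -/
theorem exists_isCostring [Module (ZMod 2) V] (hW : Monotone W) (hA : Monotone A)
    (dW : ∀ i, ∀ x ∈ W i, d x ∈ W i) (dA : ∀ i, ∀ x ∈ A i, d x ∈ A i)
    (hα : StrictMono α) (hβ : StrictAnti β) (r : ℕ) {Φ : V →+ ZMod 2}
    (h0 : ∀ x ∈ W (α 0 - 1), Φ x = 0)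
    (h1 : ∀ t ≤ r, ∀ x, x ∈ W (α (t + 1) - 1) → x ∈ A (β t - 1) → Φ x = 0)
    (h2 : ∀ x ∈ W (α 0), Φ (d x) = 0)
    (h3 : ∀ t < r, ∀ x, x ∈ W (α (t + 1)) → x ∈ A (β t) → Φ (d x) = 0)
    (h4 : ∀ x, x ∈ W (α (r + 1) - 1) → x ∈ A (β r) → Φ (d x) = 0) :
    ∃ φ ψ : ℕ → V →+ ZMod 2, (∀ x ∈ W (α 0), φ 0 x = Φ x) ∧ IsCostring d W A α β r φ ψ := by
  have split : ∀ k ≤ r + 1, ∃ φ : ℕ → V →+ ZMod 2,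
      (∀ t < k, (∀ x ∈ W (α t - 1), φ t x = 0) ∧ ∀ x ∈ A (β t - 1), φ t x = 0) ∧
      ∀ x ∈ W (α k - 1), Φ x - ∑ t ∈ Finset.range k, φ t x = 0 := by
    intro k
    induction k with
    | zero => exact fun _ => ⟨0, by simp, by simpa using h0⟩
    | succ k ih =>
      intro hk
      obtain ⟨φ, hφ, hR⟩ := ih (by omega)
      obtain ⟨p, hp, hp'⟩ := exists_functional_split (G := A (β k - 1)) (H := W (α (k + 1) - 1))
        (φ := Φ - ∑ t ∈ Finset.range k, φ t) (by
          intro x hxA hxW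
          simp only [AddMonoidHom.sub_apply, AddMonoidHom.finsetSum_apply]
          rw [h1 k (by omega) x hxW hxA, Finset.sum_eq_zero, sub_zero]
          intro t ht
          have ht := Finset.mem_range.1 ht
          exact (hφ t ht).2 x (hA (by have := hβ ht; omega) hxA))
      simp only [AddMonoidHom.sub_apply, AddMonoidHom.finsetSum_apply] at hp'
      refine ⟨fun t => if t = k then p else φ t, fun t ht => ?_, fun x hx => ?_⟩
      · by_cases htk : t = k
        · subst htk
          simp only [if_true]
          refine ⟨fun x hx => ?_, hp⟩
          have e1 := hR x hx
          have e2 := hp' x (hW (by have := hα (Nat.lt_add_one t); omega) hx)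
          rwa [e1, zero_sub, neg_eq_zero] at e2
        · simp only [if_neg htk]
          exact hφ t (by omega)
      · rw [Finset.sum_range_succ, Finset.sum_congr rfl (g := fun t => φ t x), ← sub_sub]
        · simpa using hp' x hx
        · intro t ht
          simp only [if_neg (Finset.mem_range.1 ht).ne]
  obtain ⟨φ, hφ, hR⟩ := split (r + 1) le_rfl
  have φW : ∀ t ≤ r, ∀ i < α t, ∀ x ∈ W i, φ t x = 0 := fun t ht i hi x hx =>
    (hφ t (by omega)).1 x (hW (by omega) hx)
  have φA : ∀ t ≤ r, ∀ i < β t, ∀ x ∈ A i, φ t x = 0 := fun t ht i hi x hx =>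
    (hφ t (by omega)).2 x (hA (by omega) hx)
  have sum : ∀ i < α (r + 1), ∀ x ∈ W i, Φ x = ∑ t ∈ Finset.range (r + 1), φ t x :=
    fun i hi x hx => sub_eq_zero.1 (hR x (hW (by omega) hx))
  have zero : ∀ x ∈ W (α 0), φ 0 x = Φ x := by
    intro x hx
    rw [sum _ (hα (Nat.succ_pos r)) x hx, Finset.sum_eq_single_of_mem 0 (by simp)]
    intro t ht ht0
    exact φW t (by simpa [Nat.lt_succ_iff] using ht) _ (hα (Nat.pos_of_ne_zero ht0)) x hx
  -- the middle term of the zigzag comes from splitting `(φ t + θ) ∘ d`, where `θ = φ (t + 1)`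
  -- for `t < r` and `θ = 0` for `t = r`
  have mid : ∀ t ≤ r, ∃ ψ : V →+ ZMod 2, (∀ x ∈ W (α (t + 1) - 1), ψ x = 0) ∧
      (∀ x ∈ A (β t), φ t (d x) = ψ x) ∧
      (t < r → ∀ x ∈ W (α (t + 1)), φ (t + 1) (d x) = ψ x) := by
    intro t ht
    have dA' : ∀ s < t, ∀ x ∈ A (β t), φ s (d x) = 0 := fun s hs x hx =>
      φA s (by omega) _ (hβ hs) _ (dA _ _ hx)
    rcases ht.lt_or_eq with htr | rfl
    · obtain ⟨p, hp, hp'⟩ := exists_functional_split (G := W (α (t + 1))) (H := A (β t))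
        (φ := (φ t + φ (t + 1)).comp d) (by
          intro x hxW hxA
          have := h3 t htr x hxW hxA
          rw [sum _ (hα (by omega)) _ (dW _ _ hxW), Finset.sum_eq_add_of_mem t (t + 1)
            (by simp; omega) (by simp; omega) (by omega)] at this
          · exact this
          · intro s hs hst
            have hs : s < r + 1 := Finset.mem_range.1 hs
            rcases lt_or_ge s t with h | h
            · exact dA' s h x hxA
            · exact φW s (by omega) _ (hα (by omega)) _ (dW _ _ hxW))
      simp only [AddMonoidHom.sub_apply, AddMonoidHom.comp_apply, AddMonoidHom.add_apply,
        sub_eq_zero] at hp'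
      refine ⟨(φ (t + 1)).comp d + p, fun x hx => ?_, fun x hx => ?_, fun _ x hx => ?_⟩
      · rw [AddMonoidHom.add_apply, hp x (hW (by omega) hx), AddMonoidHom.comp_apply,
          φW (t + 1) htr _ (by omega) _ (dW _ _ hx), add_zero]
      · rw [AddMonoidHom.add_apply, ← hp' x hx, AddMonoidHom.comp_apply, add_left_comm,
          ZModModule.add_self, add_zero]
      · rw [AddMonoidHom.add_apply, hp x hx, add_zero, AddMonoidHom.comp_apply]
    · obtain ⟨p, hp, hp'⟩ := exists_functional_split (G := W (α (t + 1) - 1)) (H := A (β t))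
        (φ := (φ t).comp d) (by
          intro x hxW hxA
          have := h4 x hxW hxA
          rw [sum _ (by omega) _ (dW _ _ hxW), Finset.sum_eq_single_of_mem t (by simp)] at this
          · exact this
          · intro s hs hst
            have hs := Finset.mem_range.1 hs
            exact dA' s (by omega) x hxA)
      exact ⟨p, hp, fun x hx => sub_eq_zero.1 (hp' x hx), fun h => absurd h (lt_irrefl _)⟩
  choose! ψ hψW hψA hψd using mid
  refine ⟨φ, ψ, zero, fun t ht => (hφ t (by omega)).1, fun t ht => (hφ t (by omega)).2, hψW,
    fun t ht x hx => ?_, hψA, fun t ht => hψd t ht.le ht, fun x hx => ?_⟩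
  · rw [← hψA t ht x (hA (by omega) hx)]
    exact φA t ht _ (by omega) _ (dA _ _ hx)
  · rw [zero _ (dW _ _ hx), h2 x hx]

end Strings

/-! ### The geometry of staircases -/

namespace BifilteredComplex

section Corners

/-- The horizontal coordinate of the `t`-th lower left corner of a staircase; the `t`-th upper
right corner is `(cornerW a (t + 1), cornerA τ a t)`. -/
def cornerW (a : ℕ → ℕ) (t : ℕ) : ℤ := oddSum a (2 * t)

/-- The vertical coordinate of the `t`-th lower left corner of a staircase. -/
def cornerA (τ : ℤ) (a : ℕ → ℕ) (t : ℕ) : ℤ := τ - evenSum a (2 * t)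

variable (τ : ℤ) (a : ℕ → ℕ)

theorem oddSum_succ (n : ℕ) :
    oddSum a (n + 1) = oddSum a n + if Odd (n + 1) then a (n + 1) else 0 := by
  simp only [oddSum, Finset.sum_filter]
  rw [Finset.sum_Icc_succ_top (by omega)]

theorem evenSum_succ (n : ℕ) :
    evenSum a (n + 1) = evenSum a n + if Even (n + 1) then a (n + 1) else 0 := by
  simp only [evenSum, Finset.sum_filter]
  rw [Finset.sum_Icc_succ_top (by omega)]

theorem odd_two_mul_succ (t : ℕ) : Odd (2 * t + 1) := ⟨t, rfl⟩

theorem not_even_two_mul_succ (t : ℕ) : ¬ Even (2 * t + 1) :=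
  Nat.not_even_iff_odd.2 (odd_two_mul_succ t)

theorem even_two_mul_succ_succ (t : ℕ) : Even (2 * t + 1 + 1) := ⟨t + 1, by ring⟩

theorem not_odd_two_mul_succ_succ (t : ℕ) : ¬ Odd (2 * t + 1 + 1) :=
  Nat.not_odd_iff_even.2 (even_two_mul_succ_succ t)

theorem oddSum_odd (t : ℕ) : (oddSum a (2 * t + 1) : ℤ) = cornerW a (t + 1) := by
  rw [cornerW, show 2 * (t + 1) = 2 * t + 1 + 1 by ring, oddSum_succ a (2 * t + 1),
    if_neg (not_odd_two_mul_succ_succ t), add_zero]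

theorem cornerW_zero : cornerW a 0 = 0 := by simp [cornerW, oddSum]

theorem cornerA_zero : cornerA τ a 0 = τ := by simp [cornerA, evenSum]

theorem cornerW_succ (t : ℕ) : cornerW a (t + 1) = cornerW a t + a (2 * t + 1) := by
  rw [← oddSum_odd, oddSum_succ, if_pos (odd_two_mul_succ t), cornerW]
  push_cast
  rfl

theorem cornerA_odd (t : ℕ) : τ - evenSum a (2 * t + 1) = cornerA τ a t := by
  rw [evenSum_succ, if_neg (not_even_two_mul_succ t), cornerA, add_zero]

theorem cornerA_succ (t : ℕ) : cornerA τ a (t + 1) = cornerA τ a t - a (2 * t + 2) := by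
  rw [show cornerA τ a (t + 1) = τ - evenSum a (2 * t + 1 + 1) from rfl,
    evenSum_succ a (2 * t + 1), if_pos (even_two_mul_succ_succ t), ← cornerA_odd]
  push_cast
  ring

variable {τ a}

theorem cornerW_strictMono (ha : ∀ i, 1 ≤ i → 1 ≤ a i) : StrictMono (cornerW a) :=
  strictMono_nat_of_lt_succ fun t => by
    have := ha (2 * t + 1) (by omega)
    rw [cornerW_succ]
    omega

theorem cornerA_strictAnti (ha : ∀ i, 1 ≤ i → 1 ≤ a i) : StrictAnti (cornerA τ a) :=
  strictAnti_nat_of_succ_lt fun t => by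
    have := ha (2 * t + 2) (by omega)
    rw [cornerA_succ]
    omega

end Corners

section Stair

variable {τ : ℤ} {a : ℕ → ℕ}

theorem mem_stair_zero {s : ℕ} {p : ℤ × ℤ} :
    p ∈ stair τ a (2 * 0) s ↔ min p.1 (p.2 - τ) = 0 ∧ p.1 ≤ s := Iff.rfl

theorem mem_stair_odd {t s : ℕ} {p : ℤ × ℤ} :
    p ∈ stair τ a (2 * t + 1) s ↔ p ∈ stair τ a (2 * t) (a (2 * t + 1)) ∨
      p.1 = cornerW a (t + 1) ∧ cornerA τ a t - s ≤ p.2 ∧ p.2 < cornerA τ a t := by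
  rw [stair, if_neg (not_even_two_mul_succ t), oddSum_odd, cornerA_odd]
  rfl

theorem mem_stair_even {t s : ℕ} {p : ℤ × ℤ} :
    p ∈ stair τ a (2 * (t + 1)) s ↔ p ∈ stair τ a (2 * t + 1) (a (2 * t + 2)) ∨
      p.2 = cornerA τ a (t + 1) ∧ cornerW a (t + 1) < p.1 ∧ p.1 ≤ cornerW a (t + 1) + s := by
  rw [show 2 * (t + 1) = 2 * t + 1 + 1 by ring, stair, if_pos (even_two_mul_succ_succ t)]
  rfl

theorem corner_mem_stair_odd (ha : ∀ i, 1 ≤ i → 1 ≤ a i) (t : ℕ) :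
    (cornerW a (t + 1), cornerA τ a (t + 1)) ∈ stair τ a (2 * t + 1) (a (2 * t + 2)) := by
  have := ha (2 * t + 2) (by omega)
  refine mem_stair_odd.2 (Or.inr ⟨rfl, ?_, ?_⟩) <;> simp only [cornerA_succ] <;> omega

theorem corner_mem_stair_even (ha : ∀ i, 1 ≤ i → 1 ≤ a i) (t s : ℕ) :
    (cornerW a t + s, cornerA τ a t) ∈ stair τ a (2 * t) s := by
  cases t with
  | zero => rw [mem_stair_zero, cornerW_zero, cornerA_zero]; simp
  | succ t =>
    rw [mem_stair_even]
    rcases Nat.eq_zero_or_pos s with rfl | hs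
    · left
      simpa using corner_mem_stair_odd ha t
    · right
      refine ⟨rfl, ?_, le_rfl⟩
      simp only
      omega

/-- The step from a staircase that ends with a horizontal segment to its extension by a vertical
one, for the bounds of `stair_even_upper`. -/
theorem stair_odd_upper_of_even {t s : ℕ} {p : ℤ × ℤ}
    (ih : p ∈ down (stair τ a (2 * t) (a (2 * t + 1))) →
      (p.1 ≤ 0 ∨ (∃ u < t, p.1 ≤ cornerW a (u + 1) ∧ p.2 ≤ cornerA τ a u) ∨
        (p.1 ≤ cornerW a t + a (2 * t + 1) ∧ p.2 ≤ cornerA τ a t)) ∧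
      (p ∉ stair τ a (2 * t) (a (2 * t + 1)) → p.1 ≤ 0 - 1 ∨
        (∃ u < t, p.1 ≤ cornerW a (u + 1) - 1 ∧ p.2 ≤ cornerA τ a u - 1) ∨
        (p.1 ≤ cornerW a t + a (2 * t + 1) ∧ p.2 ≤ cornerA τ a t - 1)))
    (hp : p ∈ down (stair τ a (2 * t + 1) s)) :
    (p.1 ≤ 0 ∨ ∃ u < t + 1, p.1 ≤ cornerW a (u + 1) ∧ p.2 ≤ cornerA τ a u) ∧
    (p ∉ stair τ a (2 * t + 1) s → p.1 ≤ 0 - 1 ∨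
      (∃ u < t + 1, p.1 ≤ cornerW a (u + 1) - 1 ∧ p.2 ≤ cornerA τ a u - 1) ∨
      (p.1 ≤ cornerW a (t + 1) ∧ p.2 ≤ cornerA τ a t - s - 1)) := by
  rw [← cornerW_succ] at ih
  have last (h1 : p.1 ≤ cornerW a (t + 1)) (h2 : p.2 ≤ cornerA τ a t - 1)
      (h : p ∉ stair τ a (2 * t + 1) s) : p.1 ≤ 0 - 1 ∨
      (∃ u < t + 1, p.1 ≤ cornerW a (u + 1) - 1 ∧ p.2 ≤ cornerA τ a u - 1) ∨
      (p.1 ≤ cornerW a (t + 1) ∧ p.2 ≤ cornerA τ a t - s - 1) := by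
    rw [mem_stair_odd, not_or] at h
    by_cases hc : p.1 = cornerW a (t + 1)
    · exact Or.inr (Or.inr ⟨h1, by omega⟩)
    · exact Or.inr (Or.inl ⟨t, by omega, by omega, h2⟩)
  obtain ⟨q, hq, hpq⟩ := hp
  rcases mem_stair_odd.1 hq with hq | hq
  · obtain ⟨i1, i2⟩ := ih ⟨q, hq, hpq⟩
    refine ⟨?_, fun h => ?_⟩
    · rcases i1 with h | ⟨u, hu, h⟩ | h
      · exact Or.inl h
      · exact Or.inr ⟨u, by omega, h⟩
      · exact Or.inr ⟨t, by omega, h⟩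
    · rcases i2 (fun h' => h (mem_stair_odd.2 (Or.inl h'))) with h' | ⟨u, hu, h'⟩ | h'
      · exact Or.inl h'
      · exact Or.inr (Or.inl ⟨u, by omega, h'⟩)
      · exact last h'.1 h'.2 h
  · have h1 := hpq.1
    have h2 := hpq.2
    exact ⟨Or.inr ⟨t, by omega, by omega, by omega⟩, last (by omega) (by omega)⟩

/-- The region in or below a staircase that ends with a horizontal segment lies under its upper
right corners, and the region strictly below it lies strictly under them, except for the last. -/
theorem stair_even_upper (ha : ∀ i, 1 ≤ i → 1 ≤ a i) (t : ℕ) : ∀ s : ℕ, ∀ p : ℤ × ℤ,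
    p ∈ down (stair τ a (2 * t) s) →
    (p.1 ≤ 0 ∨ (∃ u < t, p.1 ≤ cornerW a (u + 1) ∧ p.2 ≤ cornerA τ a u) ∨
      (p.1 ≤ cornerW a t + s ∧ p.2 ≤ cornerA τ a t)) ∧
    (p ∉ stair τ a (2 * t) s → p.1 ≤ 0 - 1 ∨
      (∃ u < t, p.1 ≤ cornerW a (u + 1) - 1 ∧ p.2 ≤ cornerA τ a u - 1) ∨
      (p.1 ≤ cornerW a t + s ∧ p.2 ≤ cornerA τ a t - 1)) := by
  induction t with
  | zero =>
    rintro s p ⟨q, hq, h1, h2⟩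
    rw [mem_stair_zero] at hq ⊢
    rw [cornerW_zero, cornerA_zero]
    refine ⟨?_, fun h => ?_⟩
    · by_cases h0 : p.1 ≤ 0
      · exact Or.inl h0
      · exact Or.inr (Or.inr ⟨by omega, by omega⟩)
    · by_cases h0 : p.1 ≤ 0 - 1
      · exact Or.inl h0
      · exact Or.inr (Or.inr ⟨by omega, by omega⟩)
  | succ t ih =>
    intro s p hp
    have hA := cornerA_succ τ a t
    have inner (hp : p ∈ down (stair τ a (2 * t + 1) (a (2 * t + 2)))) :=
      stair_odd_upper_of_even (ih (a (2 * t + 1)) p) hp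
    obtain ⟨q, hq, hpq⟩ := hp
    have h1 := hpq.1
    have h2 := hpq.2
    refine ⟨?_, fun h => ?_⟩
    · rcases mem_stair_even.1 hq with hq | hq
      · exact (inner ⟨q, hq, hpq⟩).1.imp_right Or.inl
      · exact Or.inr (Or.inr ⟨by omega, by omega⟩)
    · rw [mem_stair_even, not_or] at h
      have done (hp : p ∈ down (stair τ a (2 * t + 1) (a (2 * t + 2)))) : p.1 ≤ 0 - 1 ∨
          (∃ u < t + 1, p.1 ≤ cornerW a (u + 1) - 1 ∧ p.2 ≤ cornerA τ a u - 1) ∨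
          (p.1 ≤ cornerW a (t + 1) + s ∧ p.2 ≤ cornerA τ a (t + 1) - 1) :=
        ((inner hp).2 h.1).imp_right (Or.imp_right fun h => ⟨by omega, by omega⟩)
      rcases mem_stair_even.1 hq with hq | hq
      · exact done ⟨q, hq, hpq⟩
      · by_cases hc : p.2 ≤ cornerA τ a (t + 1) - 1
        · exact Or.inr (Or.inr ⟨by omega, hc⟩)
        · exact done ⟨_, corner_mem_stair_odd ha t, by simp only; omega, by simp only; omega⟩

/-- The analogue of `stair_even_upper` for a staircase that ends with a vertical segment. -/
theorem stair_odd_upper (ha : ∀ i, 1 ≤ i → 1 ≤ a i) (t s : ℕ) (p : ℤ × ℤ)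
    (hp : p ∈ down (stair τ a (2 * t + 1) s)) :
    (p.1 ≤ 0 ∨ ∃ u < t + 1, p.1 ≤ cornerW a (u + 1) ∧ p.2 ≤ cornerA τ a u) ∧
    (p ∉ stair τ a (2 * t + 1) s → p.1 ≤ 0 - 1 ∨
      (∃ u < t + 1, p.1 ≤ cornerW a (u + 1) - 1 ∧ p.2 ≤ cornerA τ a u - 1) ∨
      (p.1 ≤ cornerW a (t + 1) ∧ p.2 ≤ cornerA τ a t - s - 1)) :=
  stair_odd_upper_of_even (stair_even_upper ha t _ p) hp

theorem zero_mem_down_stair (k s : ℕ) {p : ℤ × ℤ} (hp : p.1 ≤ 0) : p ∈ down (stair τ a k s) :=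
  (compat_stair τ a k s).1 ⟨(0, p.2), rfl, hp, le_rfl⟩

theorem upper_corner_mem_stair_even (ha : ∀ i, 1 ≤ i → 1 ≤ a i) {t u : ℕ} (hu : u < t) (s : ℕ) :
    (cornerW a (u + 1), cornerA τ a u) ∈ stair τ a (2 * t) s := by
  induction t generalizing s with
  | zero => omega
  | succ t ih =>
    refine mem_stair_even.2 (Or.inl (mem_stair_odd.2 (Or.inl ?_)))
    rcases (Nat.lt_succ_iff.1 hu).lt_or_eq with h | rfl
    · exact ih h _
    · rw [cornerW_succ]
      exact corner_mem_stair_even ha u _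

/-- No point of a staircase lies strictly under one of its upper right corners. -/
theorem stair_even_lower (ha : ∀ i, 1 ≤ i → 1 ≤ a i) (t : ℕ) : ∀ s : ℕ, ∀ p ∈ stair τ a (2 * t) s,
    0 ≤ p.1 ∧ cornerA τ a t ≤ p.2 ∧
      ∀ u < t, cornerW a (u + 1) ≤ p.1 ∨ cornerA τ a u ≤ p.2 := by
  induction t with
  | zero =>
    intro s p hp
    rw [mem_stair_zero] at hp
    rw [cornerA_zero]
    exact ⟨by omega, by omega, by omega⟩
  | succ t ih =>
    intro s p hp
    rw [mem_stair_even, mem_stair_odd] at hp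
    have hA := cornerA_succ τ a t
    have h0 : 0 ≤ cornerW a (t + 1) := by simp [cornerW]
    have hmono := (cornerW_strictMono ha).monotone
    rcases hp with (hp | hp) | hp
    · obtain ⟨h1, h2, h3⟩ := ih _ p hp
      refine ⟨h1, by omega, fun u hu => ?_⟩
      rcases (Nat.lt_succ_iff.1 hu).lt_or_eq with h | rfl
      · exact h3 u h
      · exact Or.inr h2
    · exact ⟨by omega, by omega, fun u hu => Or.inl (hp.1.symm ▸ hmono hu)⟩
    · exact ⟨by omega, by omega, fun u hu => Or.inl ((hmono hu).trans hp.2.1.le)⟩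

end Stair

end BifilteredComplex

/-! ### Modules over the Laurent polynomials -/

section LaurentModule

variable {C : Type*} [AddCommGroup C] [Module LaurentF2 C]

theorem coeff_T_mul (k : ℤ) (f : LaurentF2) (j : ℤ) :
    ((LaurentPolynomial.T k : LaurentF2) * f).coeff j = f.coeff (j - k) := by
  rw [LaurentPolynomial.T, AddMonoidAlgebra.coeff_single_mul_eq_mul_coeff (j - k)
    fun _ _ => ⟨fun h => by omega, fun h => by omega⟩, one_mul]

/-- Over `ℤ/2ℤ` a Laurent polynomial is the sum of the monomials in its support. -/
theorem smul_mem_of_coeff {G : AddSubgroup C} {f : LaurentF2} {c : C}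
    (h : ∀ k, f.coeff k ≠ 0 → (LaurentPolynomial.T k : LaurentF2) • c ∈ G) : f • c ∈ G := by
  have hf : f = ∑ k ∈ f.coeff.support, LaurentPolynomial.T k := by
    ext j
    rw [AddMonoidAlgebra.coeff_sum, Finset.sum_apply']
    simp only [LaurentPolynomial.T_apply, Finset.sum_ite_eq', Finsupp.mem_support_iff]
    split_ifs with hj
    · exact (Fin.exists_fin_two.1 ⟨f.coeff j, rfl⟩).resolve_left hj
    · simpa using hj
  rw [hf, Finset.sum_smul]
  exact sum_mem fun k hk => h k (Finsupp.mem_support_iff.1 hk)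

theorem LaurentF2.add_self (f : LaurentF2) : f + f = 0 := by
  ext k
  simp [CharTwo.add_self_eq_zero]

theorem T_smul_T_smul (j k : ℤ) (c : C) : (LaurentPolynomial.T j : LaurentF2) •
    (LaurentPolynomial.T k : LaurentF2) • c = (LaurentPolynomial.T (j + k) : LaurentF2) • c := by
  rw [smul_smul, LaurentPolynomial.T_add]

variable {ι : Type*} (b : Module.Basis ι LaurentF2 C)

theorem coeff_repr_T_smul (k : ℤ) (y : C) (l : ι) (j : ℤ) :
    (b.repr ((LaurentPolynomial.T k : LaurentF2) • y) l).coeff j = (b.repr y l).coeff (j - k) := by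
  rw [map_smul, Finsupp.smul_apply, smul_eq_mul, coeff_T_mul]

variable [DecidableEq ι]

theorem coeff_repr_T_smul_basis (k : ℤ) (l l' : ι) (j : ℤ) :
    (b.repr ((LaurentPolynomial.T k : LaurentF2) • b l) l').coeff j =
      if l = l' ∧ k = j then 1 else 0 := by
  rw [coeff_repr_T_smul, Module.Basis.repr_self, Finsupp.single_apply]
  by_cases h : l = l'
  · have : (1 : LaurentF2) = LaurentPolynomial.T 0 := LaurentPolynomial.T_zero.symm
    rw [if_pos h, this, LaurentPolynomial.T_apply]
    simp [h, sub_eq_zero, eq_comm]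
  · simp [h]

variable [Fintype ι]

theorem mem_closure_monomials_iff {P : ι → ℤ → Prop} {y : C} :
    y ∈ AddSubgroup.closure
        {x | ∃ (l : ι) (k : ℤ), P l k ∧ x = (LaurentPolynomial.T k : LaurentF2) • b l} ↔
      ∀ l k, (b.repr y l).coeff k ≠ 0 → P l k := by
  constructor
  · intro hy
    induction hy using AddSubgroup.closure_induction with
    | mem x hx =>
      obtain ⟨l, k, hP, rfl⟩ := hx
      intro l' k' h
      rw [coeff_repr_T_smul_basis] at h
      obtain ⟨rfl, rfl⟩ := (ite_ne_right_iff.1 h).1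
      exact hP
    | zero => simp
    | add x y _ _ hx hy =>
      intro l k h
      by_contra hP
      refine h ?_
      rw [map_add, Finsupp.add_apply, AddMonoidAlgebra.coeff_add, Finsupp.add_apply,
        not_not.1 (mt (hx l k) hP), not_not.1 (mt (hy l k) hP), add_zero]
    | neg x _ hx =>
      intro l k h
      rw [map_neg, Finsupp.neg_apply, AddMonoidAlgebra.coeff_neg, Finsupp.neg_apply,
        neg_ne_zero] at h
      exact hx l k h
  · intro h
    rw [← b.sum_repr y]
    exact sum_mem fun l _ => smul_mem_of_coeff fun k hk =>
      AddSubgroup.subset_closure ⟨l, k, h l k hk, rfl⟩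

/-- Additive functions that agree on the monomials `T k • b l` agree. -/
theorem addMonoidHom_eq_of_monomials {G : Type*} [AddGroup G] {f g : C →+ G}
    (h : ∀ l k, f ((LaurentPolynomial.T k : LaurentF2) • b l) =
      g ((LaurentPolynomial.T k : LaurentF2) • b l)) : f = g := by
  refine AddMonoidHom.eq_of_eqOn_dense (s := {x | ∃ (l : ι) (k : ℤ), True ∧
    x = (LaurentPolynomial.T k : LaurentF2) • b l}) ?_ ?_
  · rw [eq_top_iff]
    exact fun y _ => (mem_closure_monomials_iff b).2 fun _ _ _ => trivial
  · rintro _ ⟨l, k, -, rfl⟩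
    exact h l k

end LaurentModule

namespace BifilteredData.IsFilteredBasis

variable {C : Type*} [AddCommGroup C] [Module LaurentF2 C] {X : BifilteredData C}
  {ι : Type*} [Fintype ι] [DecidableEq ι] {b : Module.Basis ι LaurentF2 C} {w al m : ι → ℤ}

theorem mem_W (hb : X.IsFilteredBasis b w al m) {i : ℤ} {y : C} :
    y ∈ X.W i ↔ ∀ l k, (b.repr y l).coeff k ≠ 0 → w l - k ≤ i := by
  rw [hb.W_eq, mem_closure_monomials_iff]

theorem mem_A (hb : X.IsFilteredBasis b w al m) {i : ℤ} {y : C} :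
    y ∈ X.A i ↔ ∀ l k, (b.repr y l).coeff k ≠ 0 → al l - k ≤ i := by
  rw [hb.A_eq, mem_closure_monomials_iff]

theorem mem_M (hb : X.IsFilteredBasis b w al m) {n : ℤ} {y : C} :
    y ∈ X.M n ↔ ∀ l k, (b.repr y l).coeff k ≠ 0 → m l - 2 * k = n := by
  rw [hb.M_eq, mem_closure_monomials_iff]

end BifilteredData.IsFilteredBasis

/-! ### Filtrations and homogeneous parts -/

namespace BifilteredComplex

variable {C : Type*} [AddCommGroup C] [Module LaurentF2 C] (X : BifilteredComplex C)

theorem W_mono : Monotone X.W := by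
  obtain ⟨N, b, w, al, m, h⟩ := X.exists_filteredBasis
  intro i j hij x hx
  rw [h.mem_W] at hx ⊢
  exact fun l k hk => (hx l k hk).trans hij

theorem A_mono : Monotone X.A := X.swap.W_mono

theorem T_smul_mem_W {i : ℤ} {y : C} (hy : y ∈ X.W i) (k : ℤ) :
    (LaurentPolynomial.T k : LaurentF2) • y ∈ X.W (i - k) := by
  obtain ⟨N, b, w, al, m, h⟩ := X.exists_filteredBasis
  rw [h.mem_W] at hy ⊢
  intro l j hj
  rw [coeff_repr_T_smul] at hj
  have := hy l _ hj
  omega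

theorem T_smul_mem_A {i : ℤ} {y : C} (hy : y ∈ X.A i) (k : ℤ) :
    (LaurentPolynomial.T k : LaurentF2) • y ∈ X.A (i - k) := X.swap.T_smul_mem_W hy k

theorem T_smul_mem_M {i : ℤ} {y : C} (hy : y ∈ X.M i) (k : ℤ) :
    (LaurentPolynomial.T k : LaurentF2) • y ∈ X.M (i - 2 * k) := by
  obtain ⟨N, b, w, al, m, h⟩ := X.exists_filteredBasis
  rw [h.mem_M] at hy ⊢
  intro l j hj
  rw [coeff_repr_T_smul] at hj
  have := hy l _ hj
  omega

theorem exists_mem_A (y : C) : ∃ j, y ∈ X.A j := by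
  obtain ⟨N, b, w, al, m, h⟩ := X.exists_filteredBasis
  let s : Finset ℤ := Finset.univ.biUnion fun l =>
    (b.repr y l).coeff.support.image fun k => al l - k
  obtain ⟨j, hj⟩ := s.bddAbove
  refine ⟨j, h.mem_A.2 fun l k hk => hj ?_⟩
  simp only [s, Finset.coe_biUnion, Set.mem_iUnion, Finset.coe_image]
  exact ⟨l, by simp, k, by simpa using hk, rfl⟩

/-- In a fixed column, low levels of the Alexander filtration are empty. -/
theorem exists_W_zero_inf_A_le : ∃ s₀ : ℤ, ∀ s ≤ s₀, X.W 0 ⊓ X.A s ≤ X.W (0 - 1) := by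
  obtain ⟨N, b, w, al, m, h⟩ := X.exists_filteredBasis
  obtain ⟨j, hj⟩ := (Finset.univ.image fun l => al l - w l).bddBelow
  refine ⟨j - 1, fun s hs x hx => h.mem_W.2 fun l k hk => ?_⟩
  have h1 := h.mem_W.1 hx.1 l k hk
  have h2 := h.mem_A.1 hx.2 l k hk
  have h3 : j ≤ al l - w l := hj (by simp)
  omega

/-- A family of maps `π m : C →+ C` consists of the projections to the homogeneous parts. -/
structure IsProjection (π : ℤ → C →+ C) : Prop where
  mem_M : ∀ m y, π m y ∈ X.M m
  of_mem : ∀ m, ∀ y ∈ X.M m, π m y = y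
  of_ne : ∀ m n, n ≠ m → ∀ y ∈ X.M n, π m y = 0
  mem_W : ∀ m i, ∀ y ∈ X.W i, π m y ∈ X.W i
  mem_A : ∀ m i, ∀ y ∈ X.A i, π m y ∈ X.A i
  exists_sum : ∀ y, ∃ s : Finset ℤ, y = ∑ m ∈ s, π m y
  d_comm : ∀ m y, π m (X.d y) = X.d (π (m + 1) y)

theorem exists_isProjection : ∃ π : ℤ → C →+ C, X.IsProjection π := by
  obtain ⟨N, b, w, al, m, h⟩ := X.exists_filteredBasis
  let π : ℤ → C →+ C := fun n => AddMonoidHom.mk' (fun y => ∑ l,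
    (if 2 * ((m l - n) / 2) = m l - n then
      (AddMonoidAlgebra.single ((m l - n) / 2) ((b.repr y l).coeff ((m l - n) / 2)) : LaurentF2)
      else 0) • b l) (by
    intro x y
    rw [← Finset.sum_add_distrib]
    refine Finset.sum_congr rfl fun l _ => ?_
    rw [← add_smul]
    split_ifs
    · rw [map_add, Finsupp.add_apply, AddMonoidAlgebra.coeff_add, Finsupp.add_apply,
        AddMonoidAlgebra.single_add]
    · simp)
  have repr : ∀ n y l k, (b.repr (π n y) l).coeff k =
      if m l - 2 * k = n then (b.repr y l).coeff k else 0 := by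
    intro n y l k
    have : b.repr (π n y) l = if 2 * ((m l - n) / 2) = m l - n then
      (AddMonoidAlgebra.single ((m l - n) / 2) ((b.repr y l).coeff ((m l - n) / 2)) : LaurentF2)
      else 0 := by
      simp only [π, AddMonoidHom.mk'_apply]
      exact congrFun (b.repr_sum_self _) l
    rw [this]
    split_ifs with h1 h2 h2
    · rw [AddMonoidAlgebra.coeff_single, show (m l - n) / 2 = k by omega, Finsupp.single_eq_same]
    · rw [AddMonoidAlgebra.coeff_single, Finsupp.single_eq_of_ne (by omega)]
    · omega
    · rfl
  have repr_ne : ∀ n y l k, (b.repr (π n y) l).coeff k ≠ 0 →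
      m l - 2 * k = n ∧ (b.repr y l).coeff k ≠ 0 := by
    intro n y l k hk
    rw [repr] at hk
    exact ite_ne_right_iff.1 hk
  have ext : ∀ x y : C, (∀ l k, (b.repr x l).coeff k = (b.repr y l).coeff k) → x = y := by
    intro x y hxy
    exact b.ext_elem fun l => LaurentPolynomial.ext fun k => hxy l k
  have mem_M : ∀ n y, π n y ∈ X.M n := fun n y => h.mem_M.2 fun l k hk => (repr_ne n y l k hk).1
  have of_mem : ∀ n, ∀ y ∈ X.M n, π n y = y := by
    intro n y hy
    refine ext _ _ fun l k => ?_
    rw [repr]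
    split_ifs with h1
    · rfl
    · by_contra h2
      exact h1 (h.mem_M.1 hy l k (Ne.symm h2))
  have of_ne : ∀ n n', n' ≠ n → ∀ y ∈ X.M n', π n y = 0 := by
    intro n n' hn y hy
    refine ext _ _ fun l k => ?_
    rw [repr, map_zero]
    split_ifs with h1
    · by_contra h2
      exact hn ((h.mem_M.1 hy l k h2).symm.trans h1)
    · rfl
  have exists_sum : ∀ y, ∃ s : Finset ℤ, y = ∑ n ∈ s, π n y := by
    intro y
    refine ⟨Finset.univ.biUnion fun l =>
      (b.repr y l).coeff.support.image fun k => m l - 2 * k, ext _ _ fun l k => ?_⟩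
    rw [map_sum, Finsupp.finsetSum_apply, AddMonoidAlgebra.coeff_sum, Finsupp.finsetSum_apply]
    simp only [repr]
    rw [Finset.sum_ite_eq]
    split_ifs with h1
    · rfl
    · by_contra h2
      refine h1 ?_
      rw [Finset.mem_biUnion]
      exact ⟨l, Finset.mem_univ _, Finset.mem_image.2 ⟨k, by simpa using h2, rfl⟩⟩
  refine ⟨π, mem_M, of_mem, of_ne, fun n i y hy => ?_, fun n i y hy => ?_, exists_sum, ?_⟩
  · exact h.mem_W.2 fun l k hk => h.mem_W.1 hy l k (repr_ne n y l k hk).2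
  · exact h.mem_A.2 fun l k hk => h.mem_A.1 hy l k (repr_ne n y l k hk).2
  · intro n y
    obtain ⟨s, hs⟩ := exists_sum y
    have key : ∀ n' , π n (X.d (π n' y)) = X.d (π (n + 1) (π n' y)) := by
      intro n'
      by_cases hn : n' = n + 1
      · subst hn
        have := X.d_M _ _ (mem_M (n + 1) y)
        rw [add_sub_cancel_right] at this
        rw [of_mem _ _ this, of_mem _ _ (mem_M _ _)]
      · rw [of_ne _ (n' - 1) (by omega) _ (X.d_M _ _ (mem_M n' y)),
          of_ne _ n' hn _ (mem_M n' y), map_zero]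
    rw [hs, map_sum, map_sum, map_sum, map_sum]
    exact Finset.sum_congr rfl fun n' _ => key n'

/-- A homogeneous additive functional is the constant coefficient of an `𝔽[U, U⁻¹]`-linear map. -/
theorem exists_linearMap_coeff {m₀ : ℤ} {φ : C →+ ZMod 2}
    (hφ : ∀ n, n ≠ m₀ → ∀ y ∈ X.M n, φ y = 0) :
    ∃ Φ : C →ₗ[LaurentF2] LaurentF2,
      ∀ y k, (Φ y).coeff k = φ ((LaurentPolynomial.T (-k) : LaurentF2) • y) := by
  obtain ⟨N, b, w, al, m, h⟩ := X.exists_filteredBasis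
  have bM : ∀ l k, (LaurentPolynomial.T k : LaurentF2) • b l ∈ X.M (m l - 2 * k) := by
    intro l k
    rw [h.mem_M]
    intro l' k' hk
    rw [coeff_repr_T_smul_basis] at hk
    obtain ⟨rfl, rfl⟩ := (ite_ne_right_iff.1 hk).1
    rfl
  let κ : Fin N → ℤ := fun l => (m₀ - m l) / 2
  let Φ : C →ₗ[LaurentF2] LaurentF2 := b.constr LaurentF2 fun l =>
    AddMonoidAlgebra.single (κ l) (φ ((LaurentPolynomial.T (-κ l) : LaurentF2) • b l))
  refine ⟨Φ, fun y k => ?_⟩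
  let f : C →+ ZMod 2 := AddMonoidHom.mk' (fun y => (Φ y).coeff k) (by
    intro x y
    rw [map_add, AddMonoidAlgebra.coeff_add, Finsupp.add_apply])
  let g : C →+ ZMod 2 := AddMonoidHom.mk'
    (fun y => φ ((LaurentPolynomial.T (-k) : LaurentF2) • y)) (by
    intro x y
    rw [smul_add, map_add])
  refine DFunLike.congr_fun (addMonoidHom_eq_of_monomials b (f := f) (g := g) fun l j => ?_) y
  simp only [f, g, AddMonoidHom.mk'_apply]
  rw [map_smul, smul_eq_mul, coeff_T_mul, Module.Basis.constr_basis,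
    AddMonoidAlgebra.coeff_single, T_smul_T_smul]
  by_cases hk : κ l = k - j
  · rw [← hk, Finsupp.single_eq_same, hk, neg_sub, neg_add_eq_sub]
  · rw [Finsupp.single_eq_of_ne (Ne.symm hk)]
    refine (hφ _ ?_ _ (bM l _)).symm
    simp only [κ] at hk
    omega

end BifilteredComplex

/-! ### Exchange in filtered bases -/

namespace BifilteredComplex

variable {C : Type*} [AddCommGroup C] [Module LaurentF2 C] (X : BifilteredComplex C)

/-- `c` is homogeneous of grading `m` and lies in filtration level `(o, v)`. -/
structure HasLevel (c : C) (o v m : ℤ) : Prop where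
  W : c ∈ X.W o
  A : c ∈ X.A v
  M : c ∈ X.M m

/-- The linear functional `Θ` is homogeneous and its values on lower levels are constrained as
those of the coordinate functional of a filtered basis element of grading `m` and level
`(o, v)`. -/
structure HasColevel (Θ : C →ₗ[LaurentF2] LaurentF2) (o v m : ℤ) : Prop where
  W : ∀ s, ∀ y ∈ X.W s, ∀ k, (Θ y).coeff k ≠ 0 → o - k ≤ s
  A : ∀ s, ∀ y ∈ X.A s, ∀ k, (Θ y).coeff k ≠ 0 → v - k ≤ s
  M : ∀ s, ∀ y ∈ X.M s, ∀ k, (Θ y).coeff k ≠ 0 → m - 2 * k = s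

variable {X}

section

variable {Θ : C →ₗ[LaurentF2] LaurentF2} {c : C} {o v m : ℤ}

/-- The rank one map `y ↦ Θ y • c` respects the filtration `W`; similarly for `A` and `M`. -/
theorem HasColevel.smul_mem_W (hΘ : X.HasColevel Θ o v m) (hc : X.HasLevel c o v m) {s : ℤ} {y : C}
    (hy : y ∈ X.W s) : Θ y • c ∈ X.W s :=
  smul_mem_of_coeff fun k hk => X.W_mono (hΘ.W s y hy k hk) (X.T_smul_mem_W hc.W k)

theorem HasColevel.smul_mem_A (hΘ : X.HasColevel Θ o v m) (hc : X.HasLevel c o v m) {s : ℤ} {y : C}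
    (hy : y ∈ X.A s) : Θ y • c ∈ X.A s :=
  smul_mem_of_coeff fun k hk => X.A_mono (hΘ.A s y hy k hk) (X.T_smul_mem_A hc.A k)

theorem HasColevel.smul_mem_M (hΘ : X.HasColevel Θ o v m) (hc : X.HasLevel c o v m) {s : ℤ} {y : C}
    (hy : y ∈ X.M s) : Θ y • c ∈ X.M s :=
  smul_mem_of_coeff fun k hk => hΘ.M s y hy k hk ▸ X.T_smul_mem_M hc.M k

end

section FilteredBasis

variable {ι : Type*} {b : Module.Basis ι LaurentF2 C} {w al m : ι → ℤ}

theorem monomials_rescale {P P' : ι → ℤ → Prop} {b' : Module.Basis ι LaurentF2 C} (c : ι → ℤ)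
    (hb' : ∀ l, b' l = (LaurentPolynomial.T (c l) : LaurentF2) • b l)
    (hP : ∀ l k, P' l k ↔ P l (k + c l)) :
    {x | ∃ (l : ι) (k : ℤ), P l k ∧ x = (LaurentPolynomial.T k : LaurentF2) • b l} =
      {x | ∃ (l : ι) (k : ℤ), P' l k ∧ x = (LaurentPolynomial.T k : LaurentF2) • b' l} := by
  ext x
  constructor
  · rintro ⟨l, k, h, rfl⟩
    refine ⟨l, k - c l, (hP _ _).2 (by rwa [sub_add_cancel]), ?_⟩
    rw [hb', T_smul_T_smul, sub_add_cancel]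
  · rintro ⟨l, k, h, rfl⟩
    exact ⟨l, k + c l, (hP _ _).1 h, by rw [hb', T_smul_T_smul]⟩

/-- Multiplying the elements of a filtered basis by powers of `U` gives a filtered basis. -/
theorem exists_isFilteredBasis_rescale (hb : X.IsFilteredBasis b w al m) (c : ι → ℤ) :
    ∃ b' : Module.Basis ι LaurentF2 C,
      X.IsFilteredBasis b' (fun l => w l - c l) (fun l => al l - c l) (fun l => m l - 2 * c l) ∧
      (∀ l, b' l = (LaurentPolynomial.T (c l) : LaurentF2) • b l) ∧
      ∀ y l k, (b'.repr y l).coeff k = (b.repr y l).coeff (k + c l) := by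
  let b' := b.unitsSMul fun l => (⟨LaurentPolynomial.T (c l), LaurentPolynomial.T (-c l),
    by rw [← LaurentPolynomial.T_add, add_neg_cancel, LaurentPolynomial.T_zero],
    by rw [← LaurentPolynomial.T_add, neg_add_cancel, LaurentPolynomial.T_zero]⟩ : LaurentF2ˣ)
  have hb' : ∀ l, b' l = (LaurentPolynomial.T (c l) : LaurentF2) • b l := fun l => by
    rw [Module.Basis.unitsSMul_apply, Units.smul_def]
  refine ⟨b', ⟨fun i => ?_, fun i => ?_, fun i => ?_⟩, hb', fun y l k => ?_⟩
  · rw [hb.W_eq, monomials_rescale c hb' fun l k => ?_]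
    omega
  · rw [hb.A_eq, monomials_rescale c hb' fun l k => ?_]
    omega
  · rw [hb.M_eq, monomials_rescale c hb' fun l k => ?_]
    omega
  · rw [Module.Basis.repr_unitsSMul, Units.smul_def, smul_eq_mul]
    refine (coeff_T_mul (-c l) _ k).trans ?_
    rw [sub_neg_eq_add]

variable [Fintype ι] [DecidableEq ι]

theorem hasLevel_basis (hb : X.IsFilteredBasis b w al m) (l : ι) :
    X.HasLevel (b l) (w l) (al l) (m l) := by
  have key (l' : ι) (k : ℤ) (hk : (b.repr (b l) l').coeff k ≠ 0) : l' = l ∧ k = 0 := by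
    rw [← one_smul LaurentF2 (b l), ← LaurentPolynomial.T_zero, coeff_repr_T_smul_basis] at hk
    obtain ⟨h1, h2⟩ := (ite_ne_right_iff.1 hk).1
    exact ⟨h1.symm, h2.symm⟩
  refine ⟨hb.mem_W.2 ?_, hb.mem_A.2 ?_, hb.mem_M.2 ?_⟩ <;>
  · intro l' k hk
    obtain ⟨rfl, rfl⟩ := key l' k hk
    simp

theorem hasColevel_coord (hb : X.IsFilteredBasis b w al m) (l : ι) :
    X.HasColevel (b.coord l) (w l) (al l) (m l) :=
  ⟨fun _ _ hy => hb.mem_W.1 hy l, fun _ _ hy => hb.mem_A.1 hy l, fun _ _ hy => hb.mem_M.1 hy l⟩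

theorem closure_monomials_map {P : ι → ℤ → Prop} {G : AddSubgroup C}
    (hG : G = AddSubgroup.closure
      {x | ∃ (l : ι) (k : ℤ), P l k ∧ x = (LaurentPolynomial.T k : LaurentF2) • b l})
    (f : C ≃ₗ[LaurentF2] C) (hf : ∀ y ∈ G, f y ∈ G) (hf' : ∀ y ∈ G, f.symm y ∈ G) :
    G = AddSubgroup.closure
      {x | ∃ (l : ι) (k : ℤ), P l k ∧ x = (LaurentPolynomial.T k : LaurentF2) • b.map f l} := by
  ext y
  have h (y : C) : y ∈ G ↔ ∀ l k, (b.repr y l).coeff k ≠ 0 → P l k := by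
    rw [hG, mem_closure_monomials_iff]
  rw [mem_closure_monomials_iff (b.map f), show (b.map f).repr y = b.repr (f.symm y) from rfl,
    ← h]
  exact ⟨hf' y, fun hy => f.apply_symm_apply y ▸ hf _ hy⟩

/-- A filtered automorphism maps a filtered basis to a filtered basis. -/
theorem isFilteredBasis_map (hb : X.IsFilteredBasis b w al m) (f : C ≃ₗ[LaurentF2] C)
    (hW : ∀ s, ∀ y ∈ X.W s, f y ∈ X.W s ∧ f.symm y ∈ X.W s)
    (hA : ∀ s, ∀ y ∈ X.A s, f y ∈ X.A s ∧ f.symm y ∈ X.A s)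
    (hM : ∀ s, ∀ y ∈ X.M s, f y ∈ X.M s ∧ f.symm y ∈ X.M s) :
    X.IsFilteredBasis (b.map f) w al m :=
  ⟨fun i => closure_monomials_map (hb.W_eq i) f (fun y hy => (hW i y hy).1)
      fun y hy => (hW i y hy).2,
    fun i => closure_monomials_map (hb.A_eq i) f (fun y hy => (hA i y hy).1)
      fun y hy => (hA i y hy).2,
    fun i => closure_monomials_map (hb.M_eq i) f (fun y hy => (hM i y hy).1)
      fun y hy => (hM i y hy).2⟩

/-- If `x` has the level of the basis element `b l`, and the functional `Φ` the corresponding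
colevel, with `x` and `b l` normalized, then `x` can take the place of `b l` in a filtered basis
whose other elements lie in the kernel of `Φ`. -/
theorem exists_isFilteredBasis_exchange (hb : X.IsFilteredBasis b w al m) {l : ι} {x : C}
    {Φ : C →ₗ[LaurentF2] LaurentF2} (hx : X.HasLevel x (w l) (al l) (m l))
    (hΦ : X.HasColevel Φ (w l) (al l) (m l)) (hΦx : Φ x = 1) (hΦb : Φ (b l) = 1)
    (hbx : b.coord l x = 1) :
    ∃ b' : Module.Basis ι LaurentF2 C, X.IsFilteredBasis b' w al m ∧ b' l = x ∧
      ∀ p ≠ l, b' p = b p + Φ (b p) • x := by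
  have two : ∀ y : C, y + y = 0 := fun y => by
    rw [← one_smul LaurentF2 y, ← add_smul, LaurentF2.add_self, zero_smul]
  have hbl : b.coord l (b l) = 1 := by simp
  -- `f` fixes `b p` up to a multiple of `x` for `p ≠ l` and maps `b l` to `x`; since the matrix of
  -- `(Φ, b.coord l)` on `(x, b l)` has all entries `1`, `f` interchanges the two functionals, and
  -- its inverse `g` arises from it by interchanging them
  let f : C →ₗ[LaurentF2] C :=
    LinearMap.id + (b.coord l).smulRight (b l) + Φ.smulRight x
  let g : C →ₗ[LaurentF2] C :=
    LinearMap.id + Φ.smulRight (b l) + (b.coord l).smulRight x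
  have hf : ∀ y, f y = y + b.coord l y • b l + Φ y • x := fun y => rfl
  have hg : ∀ y, g y = y + Φ y • b l + b.coord l y • x := fun y => rfl
  have gf : ∀ y, g (f y) = y := fun y => by
    have h1 : Φ (f y) = b.coord l y := by
      rw [hf, map_add, map_add, map_smul, map_smul, hΦx, hΦb, smul_eq_mul, smul_eq_mul, mul_one,
        mul_one, add_right_comm, LaurentF2.add_self, zero_add]
    have h2 : b.coord l (f y) = Φ y := by
      rw [hf, map_add, map_add, map_smul, map_smul, hbl, hbx, smul_eq_mul, smul_eq_mul, mul_one,
        mul_one, LaurentF2.add_self, zero_add]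
    rw [hg, h1, h2, hf]
    rw [show y + b.coord l y • b l + Φ y • x + b.coord l y • b l + Φ y • x =
      y + (b.coord l y • b l + b.coord l y • b l) + (Φ y • x + Φ y • x) by abel, two, two,
      add_zero, add_zero]
  have fg : ∀ y, f (g y) = y := fun y => by
    have h1 : Φ (g y) = b.coord l y := by
      rw [hg, map_add, map_add, map_smul, map_smul, hΦx, hΦb, smul_eq_mul, smul_eq_mul, mul_one,
        mul_one, LaurentF2.add_self, zero_add]
    have h2 : b.coord l (g y) = Φ y := by
      rw [hg, map_add, map_add, map_smul, map_smul, hbl, hbx, smul_eq_mul, smul_eq_mul, mul_one,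
        mul_one, add_right_comm, LaurentF2.add_self, zero_add]
    rw [hf, h1, h2, hg]
    rw [show y + Φ y • b l + b.coord l y • x + Φ y • b l + b.coord l y • x =
      y + (Φ y • b l + Φ y • b l) + (b.coord l y • x + b.coord l y • x) by abel, two, two,
      add_zero, add_zero]
  let F : C ≃ₗ[LaurentF2] C := { f with
    invFun := g
    left_inv := gf
    right_inv := fg }
  have hl := hasLevel_basis hb l
  have hc := hasColevel_coord hb l
  refine ⟨b.map F, isFilteredBasis_map hb F (fun s y hy => ⟨?_, ?_⟩) (fun s y hy => ⟨?_, ?_⟩)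
    (fun s y hy => ⟨?_, ?_⟩), ?_, fun p hp => ?_⟩
  · exact add_mem (add_mem hy (hc.smul_mem_W hl hy)) (hΦ.smul_mem_W hx hy)
  · exact add_mem (add_mem hy (hΦ.smul_mem_W hl hy)) (hc.smul_mem_W hx hy)
  · exact add_mem (add_mem hy (hc.smul_mem_A hl hy)) (hΦ.smul_mem_A hx hy)
  · exact add_mem (add_mem hy (hΦ.smul_mem_A hl hy)) (hc.smul_mem_A hx hy)
  · exact add_mem (add_mem hy (hc.smul_mem_M hl hy)) (hΦ.smul_mem_M hx hy)
  · exact add_mem (add_mem hy (hΦ.smul_mem_M hl hy)) (hc.smul_mem_M hx hy)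
  · change f (b l) = x
    rw [hf, hbl, hΦb, one_smul, one_smul, two, zero_add]
  · change f (b p) = _
    rw [hf, Module.Basis.coord_apply, Module.Basis.repr_self, Finsupp.single_eq_of_ne (Ne.symm hp),
      zero_smul, add_zero]

theorem eq_one_of_coeff {f : LaurentF2} (h0 : f.coeff 0 ≠ 0) (h : ∀ k, f.coeff k ≠ 0 → k = 0) :
    f = 1 := by
  rw [← LaurentPolynomial.T_zero]
  ext k
  rw [LaurentPolynomial.T_apply]
  split_ifs with hk
  · subst hk
    exact (Fin.exists_fin_two.1 ⟨f.coeff 0, rfl⟩).resolve_left h0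
  · by_contra hk'
    exact hk (h k hk').symm

/-- An element and a functional of dual levels that pair to `1` can be exchanged into a filtered
basis; the index `l` where this happens is one on whose basis element the functional is not
zero. -/
theorem exists_isFilteredBasis_insert (hb : X.IsFilteredBasis b w al m) {x : C} {o v n : ℤ}
    {Φ : C →ₗ[LaurentF2] LaurentF2} (hx : X.HasLevel x o v n) (hΦ : X.HasColevel Φ o v n)
    (hΦx : Φ x = 1) :
    ∃ (l : ι) (c : ι → ℤ) (b' : Module.Basis ι LaurentF2 C), Φ (b l) ≠ 0 ∧ (∀ p ≠ l, c p = 0) ∧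
      w l - c l = o ∧ al l - c l = v ∧ m l - 2 * c l = n ∧
      X.IsFilteredBasis b' (fun p => w p - c p) (fun p => al p - c p) (fun p => m p - 2 * c p) ∧
      b' l = x ∧ ∀ p ≠ l, b' p = b p + Φ (b p) • x := by
  -- some term of the expansion of `Φ x` in the basis contributes to the constant coefficient
  obtain ⟨l, hl⟩ : ∃ l, (b.repr x l • Φ (b l)).coeff 0 ≠ 0 := by
    by_contra! h
    have h1 : (Φ x).coeff 0 = 0 := by
      conv_lhs => rw [← b.sum_repr x]
      rw [map_sum, AddMonoidAlgebra.coeff_sum, Finsupp.finsetSum_apply]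
      exact Finset.sum_eq_zero fun l _ => by rw [map_smul, h l]
    rw [hΦx, ← LaurentPolynomial.T_zero, LaurentPolynomial.T_apply] at h1
    simp at h1
  obtain ⟨j, hj, hj'⟩ : ∃ j, (b.repr x l).coeff j ≠ 0 ∧ (Φ (b l)).coeff (0 - j) ≠ 0 := by
    by_contra! h
    refine hl ?_
    let G : AddSubgroup LaurentF2 := (AddMonoidHom.mk' (fun f : LaurentF2 => f.coeff 0)
      fun f g => by rw [AddMonoidAlgebra.coeff_add, Finsupp.add_apply]).ker
    refine smul_mem_of_coeff (G := G) fun k hk => ?_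
    change ((LaurentPolynomial.T k : LaurentF2) * Φ (b l)).coeff 0 = 0
    rw [coeff_T_mul, h k hk]
  have hlev := hasLevel_basis hb l
  have hco := hasColevel_coord hb l
  have hw : w l - j = o := by
    have h1 := hco.W _ _ hx.W j hj
    have h2 := hΦ.W _ _ hlev.W _ hj'
    omega
  have ha : al l - j = v := by
    have h1 := hco.A _ _ hx.A j hj
    have h2 := hΦ.A _ _ hlev.A _ hj'
    omega
  have hm : m l - 2 * j = n := hco.M _ _ hx.M j hj
  let c : ι → ℤ := fun p => if p = l then j else 0
  obtain ⟨b₁, hb₁, hbb, hrep⟩ := exists_isFilteredBasis_rescale hb c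
  have hc : c l = j := if_pos rfl
  have hc' : ∀ p ≠ l, c p = 0 := fun p hp => if_neg hp
  have hbl : b l = (LaurentPolynomial.T (-j) : LaurentF2) • b₁ l := by
    rw [hbb, hc, T_smul_T_smul, neg_add_cancel, LaurentPolynomial.T_zero, one_smul]
  have hbp : ∀ p ≠ l, b₁ p = b p := fun p hp => by
    rw [hbb, hc' p hp, LaurentPolynomial.T_zero, one_smul]
  have hΦb : Φ (b₁ l) = 1 := by
    refine eq_one_of_coeff ?_ fun k hk => ?_
    · rwa [hbb, hc, map_smul, smul_eq_mul, coeff_T_mul]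
    · have := hΦ.M _ _ (hasLevel_basis hb₁ l).M k hk
      simp only [hc] at this
      omega
  have hcoord : b₁.coord l x = 1 := by
    refine eq_one_of_coeff ?_ fun k hk => ?_
    · rw [Module.Basis.coord_apply, hrep, hc, zero_add]
      exact hj
    · have := (hasColevel_coord hb₁ l).M _ _ hx.M k hk
      simp only [hc] at this
      omega
  obtain ⟨b', hb', hb'l, hb'p⟩ := exists_isFilteredBasis_exchange hb₁ (l := l) (x := x) (Φ := Φ)
    (by simpa only [hc, hw, ha, hm] using hx) (by simpa only [hc, hw, ha, hm] using hΦ)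
    hΦx hΦb hcoord
  refine ⟨l, c, b', fun h => hj' (by rw [h]; rfl), hc', ?_, ?_, ?_, hb', hb'l,
    fun p hp => ?_⟩
  · rw [hc, hw]
  · rw [hc, ha]
  · rw [hc, hm]
  · rw [hb'p p hp, hbp p hp]

end FilteredBasis

end BifilteredComplex

/-! ### Completing dual families to filtered bases -/

namespace BifilteredComplex

variable {C : Type*} [AddCommGroup C] [Module LaurentF2 C] {X : BifilteredComplex C}

/-- Elements and functionals that are dual to each other, in level and under the pairing, are part
of a filtered basis and of its dual basis. -/
theorem exists_isFilteredBasis_dual {n : ℕ} {x : ℕ → C} {Φ : ℕ → C →ₗ[LaurentF2] LaurentF2}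
    {o v m : ℕ → ℤ} (hx : ∀ i ≤ n, X.HasLevel (x i) (o i) (v i) (m i))
    (hΦ : ∀ i ≤ n, X.HasColevel (Φ i) (o i) (v i) (m i))
    (hδ : ∀ i ≤ n, ∀ j ≤ n, Φ i (x j) = if j = i then 1 else 0) :
    ∃ (N : ℕ) (b : Module.Basis (Fin N) LaurentF2 C) (w al m' : Fin N → ℤ) (e : ℕ → Fin N),
      X.IsFilteredBasis b w al m' ∧ Set.InjOn e (Set.Iic n) ∧
      (∀ i ≤ n, b (e i) = x i ∧ w (e i) = o i ∧ al (e i) = v i) ∧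
      ∀ i ≤ n, ∀ y, b.repr y (e i) = Φ i y := by
  obtain ⟨N, b, w, al, m', hb⟩ := X.exists_filteredBasis
  have hN : 0 < N := by
    rcases Nat.eq_zero_or_pos N with rfl | h
    · have h0 : x 0 = 0 := b.ext_elem fun i => i.elim0
      have h1 := hδ 0 (Nat.zero_le n) 0 (Nat.zero_le n)
      rw [h0, map_zero, if_pos rfl] at h1
      exact absurd h1 zero_ne_one
    · exact h
  have step : ∀ k ≤ n + 1, ∃ (b : Module.Basis (Fin N) LaurentF2 C) (w al m' : Fin N → ℤ)
      (e : ℕ → Fin N), X.IsFilteredBasis b w al m' ∧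
      (∀ i < k, b (e i) = x i ∧ w (e i) = o i ∧ al (e i) = v i) ∧
      ∀ i < k, ∀ p, Φ i (b p) = if p = e i then 1 else 0 := by
    intro k
    induction k with
    | zero => exact fun _ => ⟨b, w, al, m', fun _ => ⟨0, hN⟩, hb, by simp, by simp⟩
    | succ k ih =>
      intro hk
      obtain ⟨b, w, al, m', e, hb, he, hd⟩ := ih (by omega)
      have hkn : k ≤ n := by omega
      obtain ⟨l, c, b', hl, hc, hw, ha, -, hb', hbl, hbp⟩ := exists_isFilteredBasis_insert hb
        (hx k hkn) (hΦ k hkn) (by rw [hδ k hkn k hkn, if_pos rfl])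
      have hle : ∀ i < k, e i ≠ l := by
        rintro i hi rfl
        rw [(he i hi).1, hδ k hkn i (by omega), if_neg hi.ne] at hl
        exact hl rfl
      have e_of_lt : ∀ i < k, Function.update e k l i = e i :=
        fun i hi => Function.update_of_ne hi.ne l e
      refine ⟨b', _, _, _, Function.update e k l, hb', fun i hi => ?_, fun i hi p => ?_⟩
      · rcases (Nat.lt_succ_iff.1 hi).lt_or_eq with hi | rfl
        · rw [e_of_lt i hi, hc _ (hle i hi), hbp _ (hle i hi), (he i hi).1, hδ k hkn i (by omega),
            if_neg hi.ne, zero_smul, add_zero, sub_zero, sub_zero]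
          exact ⟨rfl, (he i hi).2⟩
        · rw [Function.update_self]
          exact ⟨hbl, hw, ha⟩
      · rcases (Nat.lt_succ_iff.1 hi).lt_or_eq with hi | rfl
        · rw [e_of_lt i hi]
          by_cases hp : p = l
          · subst hp
            rw [hbl, hδ i (by omega) k hkn, if_neg hi.ne', if_neg (hle i hi).symm]
          · rw [hbp p hp, map_add, map_smul, hδ i (by omega) k hkn, if_neg hi.ne', smul_zero,
              add_zero, hd i hi]
        · rw [Function.update_self]
          by_cases hp : p = l
          · subst hp
            rw [hbl, hδ _ hkn _ hkn, if_pos rfl, if_pos rfl]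
          · rw [hbp p hp, map_add, map_smul, hδ _ hkn _ hkn, if_pos rfl, smul_eq_mul, mul_one,
              LaurentF2.add_self, if_neg hp]
  obtain ⟨b, w, al, m', e, hb, he, hd⟩ := step (n + 1) le_rfl
  refine ⟨N, b, w, al, m', e, hb, ?_, fun i hi => he i (by omega), fun i hi y => ?_⟩
  · intro i hi j hj hij
    have hi : i ≤ n := hi
    have hj : j ≤ n := hj
    have h1 := hd i (by omega) (e j)
    rw [(he j (by omega)).1, hδ i hi j hj, if_pos hij.symm] at h1
    by_contra hne
    rw [if_neg (Ne.symm hne)] at h1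
    exact zero_ne_one h1
  · have : b.coord (e i) = Φ i := b.ext fun p => by
      rw [hd i (by omega), Module.Basis.coord_apply, Module.Basis.repr_self,
        Finsupp.single_apply]
    rw [← this, Module.Basis.coord_apply]

end BifilteredComplex

/-! ### Homology of subquotients -/

namespace BifilteredComplex

variable {C : Type*} [AddCommGroup C] [Module LaurentF2 C] (X : BifilteredComplex C)

/-- The elements of `C` that represent zero in the homology of `C{S}`. -/
noncomputable def nullGroup (S : Set (ℤ × ℤ)) : AddSubgroup C :=
  X.sub (down S \ S) ⊔ (X.sub (down S)).map X.d.toAddMonoidHom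

variable {X}

/-- The class in the homology of `C{S}` of an element of `C`. -/
noncomputable def homologyClass {S : Set (ℤ × ℤ)} {z : C} (hz : z ∈ X.sub (down S))
    (hdz : X.d z ∈ X.sub (down S \ S)) : X.Homology S :=
  QuotientAddGroup.mk ⟨QuotientAddGroup.mk ⟨z, hz⟩,
    (QuotientAddGroup.eq_zero_iff _).2 (show X.d z ∈ X.sub (down S \ S) from hdz)⟩

theorem exists_homologyClass {S : Set (ℤ × ℤ)} (g : X.Homology S) :
    ∃ (z : C) (hz : z ∈ X.sub (down S)) (hdz : X.d z ∈ X.sub (down S \ S)),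
      g = homologyClass hz hdz := by
  obtain ⟨⟨x, hx⟩, rfl⟩ := QuotientAddGroup.mk_surjective g
  obtain ⟨⟨z, hz⟩, rfl⟩ := QuotientAddGroup.mk_surjective x
  exact ⟨z, hz, (QuotientAddGroup.eq_zero_iff (X.dSub (down S) ⟨z, hz⟩)).1 hx, rfl⟩

theorem homologyMap_homologyClass {S S' : Set (ℤ × ℤ)} (h : Compat S S') {z : C}
    (hz : z ∈ X.sub (down S)) (hdz : X.d z ∈ X.sub (down S \ S)) :
    X.homologyMap h (homologyClass hz hdz) =
      homologyClass (X.sub_mono h.1 hz) (X.sub_mono h.2 hdz) := rfl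

theorem homologyClass_eq_zero_iff {S : Set (ℤ × ℤ)} {z : C} (hz : z ∈ X.sub (down S))
    (hdz : X.d z ∈ X.sub (down S \ S)) : homologyClass hz hdz = 0 ↔ z ∈ X.nullGroup S := by
  rw [homologyClass, QuotientAddGroup.eq_zero_iff, nullGroup, AddSubgroup.mem_sup]
  constructor
  · rintro ⟨y, hy⟩
    obtain ⟨⟨Y, hY⟩, rfl⟩ := QuotientAddGroup.mk_surjective y
    have h : -X.d Y + z ∈ X.sub (down S \ S) :=
      (QuotientAddGroup.eq (a := X.dSub (down S) ⟨Y, hY⟩) (b := ⟨z, hz⟩)).1 hy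
    exact ⟨_, h, _, ⟨Y, hY, rfl⟩, by
      rw [LinearMap.toAddMonoidHom_coe]; abel⟩
  · rintro ⟨u, hu, _, ⟨Y, hY, rfl⟩, rfl⟩
    refine ⟨QuotientAddGroup.mk ⟨Y, hY⟩, QuotientAddGroup.eq.2 ?_⟩
    change -X.d Y + (u + X.d Y) ∈ X.sub (down S \ S)
    rwa [show -X.d Y + (u + X.d Y) = u by abel]

theorem IsProjection.mem_sub {π : ℤ → C →+ C} (hπ : X.IsProjection π) (m : ℤ) {D : Set (ℤ × ℤ)}
    {y : C} (hy : y ∈ X.sub D) : π m y ∈ X.sub D := by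
  have : X.sub D ≤ (X.sub D).comap (π m) := iSup₂_le fun p hp x hx =>
    (le_biSup (fun p : ℤ × ℤ => X.W p.1 ⊓ X.A p.2) hp : _ ≤ X.sub D)
      ⟨hπ.mem_W m _ x hx.1, hπ.mem_A m _ x hx.2⟩
  exact this hy

variable (X)

theorem mem_sub_of_le {D : Set (ℤ × ℤ)} {p : ℤ × ℤ} (hp : p ∈ D) {x : C} (h1 : x ∈ X.W p.1)
    (h2 : x ∈ X.A p.2) : x ∈ X.sub D :=
  (le_biSup (fun p : ℤ × ℤ => X.W p.1 ⊓ X.A p.2) hp : _ ≤ X.sub D) ⟨h1, h2⟩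

theorem W_le_sub {D : Set (ℤ × ℤ)} {i : ℤ} (h : ∀ p : ℤ × ℤ, p.1 ≤ i → p ∈ D) :
    X.W i ≤ X.sub D := fun x hx => by
  obtain ⟨j, hj⟩ := X.exists_mem_A x
  exact X.mem_sub_of_le (p := (i, j)) (h _ le_rfl) hx hj

theorem sub_le_W {D : Set (ℤ × ℤ)} {i : ℤ} (h : ∀ p ∈ D, p.1 ≤ i) : X.sub D ≤ X.W i :=
  iSup₂_le fun p hp _ hx => X.W_mono (h p hp) hx.1

theorem sub_down_column : X.sub (down (column 0)) = X.W 0 := by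
  refine le_antisymm (X.sub_le_W ?_) (X.W_le_sub fun p hp => ⟨(0, p.2), rfl, hp, le_rfl⟩)
  rintro p ⟨q, hq, hpq⟩
  exact hpq.1.trans_eq hq

theorem sub_down_column_diff : X.sub (down (column 0) \ column 0) = X.W (0 - 1) := by
  refine le_antisymm (X.sub_le_W ?_) (X.W_le_sub fun p hp =>
    ⟨⟨(0, p.2), rfl, by simp only; omega, le_rfl⟩, fun h : p.1 = 0 => by omega⟩)
  rintro p ⟨⟨q, hq, hpq⟩, hp⟩
  have h1 : p.1 ≤ q.1 := hpq.1
  have h2 : q.1 = 0 := hq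
  have h3 : p.1 ≠ 0 := hp
  omega

/-- A homogeneous cycle that generates the homology of the column `{i = 0}`; a map out of this
homology is zero if and only if it kills the class of the generator. -/
structure IsColumnGenerator (z : C) (m₀ : ℤ) : Prop where
  W : z ∈ X.W 0
  M : z ∈ X.M m₀
  d_W : X.d z ∈ X.W (0 - 1)
  notMem_nullGroup : z ∉ X.nullGroup (column 0)
  homologyMap_eq_zero_iff : ∀ {S : Set (ℤ × ℤ)} (h : Compat (column 0) S),
    X.homologyMap h = 0 ↔ z ∈ X.nullGroup S

theorem exists_isColumnGenerator (h : Nonempty (X.Homology (column 0) ≃+ ZMod 2)) :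
    ∃ z m₀, X.IsColumnGenerator z m₀ := by
  obtain ⟨f⟩ := h
  obtain ⟨π, hπ⟩ := X.exists_isProjection
  obtain ⟨z, hz, hdz, hg⟩ := exists_homologyClass (f.symm 1)
  have hz0 : z ∉ X.nullGroup (column 0) := by
    rw [← homologyClass_eq_zero_iff hz hdz, ← hg]
    simp
  -- one of the homogeneous parts of `z` is not null-homologous
  obtain ⟨m₀, hm⟩ : ∃ m, π m z ∉ X.nullGroup (column 0) := by
    by_contra! hm
    obtain ⟨s, hs⟩ := hπ.exists_sum z
    refine hz0 ?_
    rw [hs]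
    exact sum_mem fun m _ => hm m
  have hz' := hπ.mem_sub m₀ hz
  have hdz' : X.d (π m₀ z) ∈ X.sub (down (column 0) \ column 0) := by
    have := hπ.mem_sub (m₀ - 1) hdz
    rwa [hπ.d_comm, sub_add_cancel] at this
  refine ⟨π m₀ z, m₀, X.sub_down_column ▸ hz', hπ.mem_M _ _, X.sub_down_column_diff ▸ hdz',
    hm, fun {S} hS => ?_⟩
  rw [← homologyClass_eq_zero_iff (X.sub_mono hS.1 hz') (X.sub_mono hS.2 hdz'),
    ← homologyMap_homologyClass hS hz' hdz']
  refine ⟨fun h => by rw [h]; rfl, fun h => AddMonoidHom.ext fun g => ?_⟩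
  have hne : homologyClass hz' hdz' ≠ 0 := fun h => hm ((homologyClass_eq_zero_iff _ _).1 h)
  have two : ∀ r : ZMod 2, r = 0 ∨ r = 1 := by decide
  rcases two (f g) with h0 | h1
  · rw [(map_eq_zero_iff f f.injective).1 h0, map_zero, map_zero]
  · have h2 := (two (f (homologyClass hz' hdz'))).resolve_left
      (fun h => hne ((map_eq_zero_iff f f.injective).1 h))
    rw [f.injective (h1.trans h2.symm), h]
    rfl

variable {X}

/-- Minimality of `τ`: the class of a generator is not carried by lower Alexander levels. -/
theorem IsColumnGenerator.stairMap_zero_ne {z : C} {m₀ : ℤ} (hz : X.IsColumnGenerator z m₀)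
    (a : ℕ → ℕ) : X.stairMap a 0 0 ≠ 0 := by
  intro h0
  set τ := X.tau with hτ
  have hnull : z ∈ X.nullGroup (stair τ a 0 0) :=
    (hz.homologyMap_eq_zero_iff (compat_stair τ a 0 0)).1 h0
  have bdd : BddBelow {s : ℤ | X.homologyMap (compat_column_le s) ≠ 0} := by
    obtain ⟨s₀, hs₀⟩ := X.exists_W_zero_inf_A_le
    refine ⟨s₀, fun s hs => ?_⟩
    by_contra! hlt
    refine hs (AddMonoidHom.ext fun g => ?_)
    obtain ⟨y, hy, hdy, rfl⟩ := exists_homologyClass g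
    rw [homologyMap_homologyClass, AddMonoidHom.zero_apply, homologyClass_eq_zero_iff]
    refine AddSubgroup.mem_sup_left ?_
    rw [sub_down_column_diff]
    refine hs₀ s hlt.le ?_
    refine (iSup₂_le ?_ : X.sub (down {p : ℤ × ℤ | p.1 = 0 ∧ p.2 ≤ s}) ≤ X.W 0 ⊓ X.A s) hy
    rintro p ⟨q, hq, hpq⟩ x hx
    exact ⟨X.W_mono (hpq.1.trans_eq hq.1) hx.1, X.A_mono (hpq.2.trans hq.2) hx.2⟩
  obtain ⟨u, hu, _, ⟨Y, hY, rfl⟩, hsum⟩ := AddSubgroup.mem_sup.1 hnull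
  have hYW : Y ∈ X.W 0 := by
    refine X.sub_le_W (D := down (stair τ a 0 0)) ?_ hY
    rintro p ⟨q, hq, hpq⟩
    exact hpq.1.trans hq.2
  have hu' : u ∈ X.W (0 - 1) ⊔ (X.W 0 ⊓ X.A (τ - 1)) := by
    refine (iSup₂_le ?_ : X.sub (down (stair τ a 0 0) \ stair τ a 0 0) ≤ _) hu
    rintro p ⟨⟨q, hq, h1, h2⟩, hp⟩ x hx
    rw [stair, Set.mem_ofPred_eq] at hq hp
    by_cases h : p.1 ≤ 0 - 1
    · exact AddSubgroup.mem_sup_left (X.W_mono h hx.1)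
    · refine AddSubgroup.mem_sup_right ⟨X.W_mono ?_ hx.1, X.A_mono ?_ hx.2⟩ <;> omega
  obtain ⟨u₁, hu₁, u₂, hu₂, rfl⟩ := AddSubgroup.mem_sup.1 hu'
  have hu₂z : u₂ = z - u₁ - X.d Y := by
    rw [← hsum, LinearMap.toAddMonoidHom_coe]; abel
  have base : ((0, τ - 1) : ℤ × ℤ) ∈ down {p : ℤ × ℤ | p.1 = 0 ∧ p.2 ≤ τ - 1} :=
    ⟨(0, τ - 1), ⟨rfl, le_rfl⟩, le_rfl⟩
  have base' : ((0 - 1, τ - 1) : ℤ × ℤ) ∈ down {p : ℤ × ℤ | p.1 = 0 ∧ p.2 ≤ τ - 1} :=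
    ⟨(0, τ - 1), ⟨rfl, le_rfl⟩, by constructor <;> simp⟩
  have h1 : u₂ ∈ X.sub (down {p : ℤ × ℤ | p.1 = 0 ∧ p.2 ≤ τ - 1}) :=
    X.mem_sub_of_le (p := (0, τ - 1)) base hu₂.1 hu₂.2
  have h2 : X.d u₂ ∈ X.sub (down {p : ℤ × ℤ | p.1 = 0 ∧ p.2 ≤ τ - 1} \
      {p : ℤ × ℤ | p.1 = 0 ∧ p.2 ≤ τ - 1}) := by
    refine X.mem_sub_of_le (p := (0 - 1, τ - 1))
      (show _ ∈ _ \ _ from ⟨base', fun h => absurd h.1 (by simp)⟩) ?_ (X.d_A _ _ hu₂.2)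
    rw [hu₂z, map_sub, map_sub, X.d_d, sub_zero]
    exact sub_mem hz.d_W (X.d_W _ _ hu₁)
  have hmem : τ - 1 ∈ {s : ℤ | X.homologyMap (compat_column_le s) ≠ 0} := by
    intro h
    have h3 := DFunLike.congr_fun h (homologyClass h1 h2)
    rw [homologyMap_homologyClass, AddMonoidHom.zero_apply, homologyClass_eq_zero_iff] at h3
    refine hz.notMem_nullGroup ?_
    have : z = u₂ + (u₁ + X.d Y) := by rw [hu₂z]; abel
    rw [this]
    refine add_mem h3 (add_mem (AddSubgroup.mem_sup_left ?_) (AddSubgroup.mem_sup_right ?_))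
    · rw [sub_down_column_diff]; exact hu₁
    · exact ⟨Y, by rw [sub_down_column]; exact hYW, rfl⟩
  have := csInf_le bdd hmem
  rw [← tau, ← hτ] at this
  omega

end BifilteredComplex

/-! ### Zigzags from staircases -/

theorem AddSubgroup.exists_eq_add_sum {G : Type*} [AddCommGroup G] {K H : AddSubgroup G}
    {F : ℕ → AddSubgroup G} {r : ℕ} (h : K ≤ H ⊔ ⨆ u ∈ Finset.range r, F u) {x : G} (hx : x ∈ K) :
    ∃ c ∈ H, ∃ y : ℕ → G, (∀ u < r, y u ∈ F u) ∧ x = c + ∑ u ∈ Finset.range r, y u := by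
  induction r generalizing H with
  | zero => exact ⟨x, by simpa using h hx, 0, by simp, by simp⟩
  | succ r ih =>
    rw [Finset.range_add_one, Finset.iSup_insert, ← sup_assoc] at h
    obtain ⟨c, hc, y, hy, rfl⟩ := ih h
    obtain ⟨c', hc', f, hf, rfl⟩ := AddSubgroup.mem_sup.1 hc
    refine ⟨c', hc', fun u => if u = r then f else y u, fun u hu => ?_, ?_⟩
    · by_cases hur : u = r
      · simpa [hur] using hf
      · simpa [hur] using hy u (by omega)
    · have : ∑ u ∈ Finset.range r, (if u = r then f else y u) = ∑ u ∈ Finset.range r, y u :=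
        Finset.sum_congr rfl fun u hu => if_neg (Finset.mem_range.1 hu).ne
      rw [Finset.sum_range_succ, if_pos rfl, this]
      abel

namespace BifilteredComplex

variable {C : Type*} [AddCommGroup C] [Module LaurentF2 C] {X : BifilteredComplex C}

theorem two_nsmul_eq_zero (y : C) : (2 : ℕ) • y = 0 := by
  have h : (2 : LaurentF2) = 0 := by
    have h1 : (LaurentPolynomial.C (2 : ZMod 2) : LaurentF2) = 0 := by
      rw [show (2 : ZMod 2) = 0 from rfl, map_zero]
    rwa [map_ofNat] at h1
  rw [← Nat.cast_smul_eq_nsmul LaurentF2, Nat.cast_ofNat, h, zero_smul]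

section Extraction

variable {a : ℕ → ℕ} {z : C} {m₀ : ℤ}

/-- If the generator dies in the homology of a staircase, a null-homology is a string. -/
theorem IsColumnGenerator.exists_isString (hz : X.IsColumnGenerator z m₀)
    (ha : ∀ i, 1 ≤ i → 1 ≤ a i) {τ : ℤ} {r : ℕ}
    (h : z ∈ X.nullGroup (stair τ a (2 * r + 1) (a (2 * r + 2) - 1))) :
    ∃ (q y : ℕ → C) (Y u : C), Y ∈ X.W 0 ∧ u ∈ X.W (0 - 1) ∧ q 0 = z + X.d Y + u ∧
      IsString X.d.toAddMonoidHom X.W X.A (cornerW a) (cornerA τ a) (r + 1) q y := by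
  let _ : Module (ZMod 2) C := AddCommGroup.zmodModule two_nsmul_eq_zero
  have h2 := ha (2 * r + 2) (by omega)
  have hA := cornerA_succ τ a r
  obtain ⟨u', hu', _, ⟨Y', hY', rfl⟩, hsum⟩ := AddSubgroup.mem_sup.1 h
  obtain ⟨Y, hY, y, hy, rfl⟩ := AddSubgroup.exists_eq_add_sum (H := X.W 0) (r := r + 1)
    (F := fun t => X.W (cornerW a (t + 1)) ⊓ X.A (cornerA τ a t)) (by
      refine iSup₂_le fun p hp x hx => ?_
      rcases (stair_odd_upper ha r _ p hp).1 with h1 | ⟨t, ht, h1, h3⟩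
      · exact AddSubgroup.mem_sup_left (X.W_mono h1 hx.1)
      · exact AddSubgroup.mem_sup_right (le_biSup (fun t =>
          X.W (cornerW a (t + 1)) ⊓ X.A (cornerA τ a t)) (Finset.mem_range.2 ht)
          ⟨X.W_mono h1 hx.1, X.A_mono h3 hx.2⟩)) hY'
  obtain ⟨c, hc, v, hv, rfl⟩ := AddSubgroup.exists_eq_add_sum
    (H := X.W (0 - 1) ⊔ X.A (cornerA τ a (r + 1))) (r := r + 1)
    (F := fun t => X.W (cornerW a (t + 1) - 1) ⊓ X.A (cornerA τ a t - 1)) (by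
      refine iSup₂_le fun p hp x hx => ?_
      rcases (stair_odd_upper ha r _ p hp.1).2 hp.2 with h1 | ⟨t, ht, h1, h3⟩ | ⟨h1, h3⟩
      · exact AddSubgroup.mem_sup_left (AddSubgroup.mem_sup_left (X.W_mono h1 hx.1))
      · exact AddSubgroup.mem_sup_right (le_biSup (fun t =>
          X.W (cornerW a (t + 1) - 1) ⊓ X.A (cornerA τ a t - 1)) (Finset.mem_range.2 ht)
          ⟨X.W_mono h1 hx.1, X.A_mono h3 hx.2⟩)
      · exact AddSubgroup.mem_sup_left (AddSubgroup.mem_sup_right (X.A_mono (by omega) hx.2))) hu'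
  obtain ⟨u, hu, e, he, rfl⟩ := AddSubgroup.mem_sup.1 hc
  have hα0 := cornerW_zero a
  obtain ⟨q, hq0, hq⟩ := _root_.exists_isString (d := X.d.toAddMonoidHom) X.W_mono X.A_mono X.d_W
    X.d_A X.d_d (cornerW_strictMono ha) (cornerA_strictAnti (τ := τ) ha) (r + 1) (z := z)
    (Y := -Y) (u := u) (e := e) (y := fun t => -y t) (v := v) (by rw [hα0]; exact hz.W)
    (by rw [hα0]; exact hz.d_W) (by rw [hα0]; exact neg_mem hY) (by rw [hα0]; exact hu)
    (fun t ht => neg_mem (hy t ht).1) (fun t ht => neg_mem (hy t ht).2) (fun t ht => (hv t ht).1)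
    (fun t ht => (hv t ht).2) he (by
      rw [← hsum]
      simp only [map_neg, map_add, map_sum, Finset.sum_neg_distrib]
      abel)
  exact ⟨q, _, -Y, u, neg_mem hY, hu, hq0, hq⟩

/-- If the generator survives in the homology of a staircase, a cocycle that detects it is a
costring. -/
theorem IsColumnGenerator.exists_isCostring (hz : X.IsColumnGenerator z m₀)
    (ha : ∀ i, 1 ≤ i → 1 ≤ a i) {τ : ℤ} {r : ℕ}
    (h : z ∉ X.nullGroup (stair τ a (2 * r) (a (2 * r + 1) - 1))) :
    ∃ φ ψ : ℕ → C →+ ZMod 2, φ 0 z = 1 ∧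
      IsCostring X.d.toAddMonoidHom X.W X.A (cornerW a) (cornerA τ a) r φ ψ := by
  let _ : Module (ZMod 2) C := AddCommGroup.zmodModule two_nsmul_eq_zero
  have h1 := ha (2 * r + 1) (by omega)
  have hW := cornerW_succ a r
  have hα0 := cornerW_zero a
  set S := stair τ a (2 * r) (a (2 * r + 1) - 1) with hS
  obtain ⟨Φ, hΦ, hΦz⟩ := exists_functional_of_notMem h
  have lower := stair_even_lower (τ := τ) ha r (a (2 * r + 1) - 1)
  have corner : ∀ t < r, (cornerW a (t + 1), cornerA τ a t) ∈ S :=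
    fun t ht => upper_corner_mem_stair_even ha ht _
  have last : (cornerW a (r + 1) - 1, cornerA τ a r) ∈ S := by
    have := corner_mem_stair_even (τ := τ) ha r (a (2 * r + 1) - 1)
    rwa [show cornerW a r + (a (2 * r + 1) - 1 : ℕ) = cornerW a (r + 1) - 1 by omega] at this
  have down_of_mem : ∀ p ∈ S, p ∈ down S := fun p hp => ⟨p, hp, le_rfl⟩
  have kill : ∀ x ∈ X.sub (down S \ S), Φ x = 0 := fun x hx => hΦ x (AddSubgroup.mem_sup_left hx)
  have kill_d : ∀ x ∈ X.sub (down S), Φ (X.d x) = 0 := fun x hx =>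
    hΦ _ (AddSubgroup.mem_sup_right ⟨x, hx, rfl⟩)
  obtain ⟨φ, ψ, hφ, hc⟩ := _root_.exists_isCostring (d := X.d.toAddMonoidHom) X.W_mono X.A_mono
    X.d_W X.d_A (cornerW_strictMono ha) (cornerA_strictAnti (τ := τ) ha) r (Φ := Φ)
    (fun x hx => by
      rw [hα0] at hx
      refine kill x (X.W_le_sub (fun p hp => (show p ∈ down S \ S from
        ⟨zero_mem_down_stair _ _ (by omega), fun hpS => ?_⟩)) hx)
      have := (lower p hpS).1
      omega)
    (fun t ht x hxW hxA => by
      refine kill x (X.mem_sub_of_le (p := (cornerW a (t + 1) - 1, cornerA τ a t - 1))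
        (show _ ∈ _ \ _ from ⟨?_, fun hpS => ?_⟩) hxW hxA)
      · rcases ht.lt_or_eq with ht | rfl
        · exact ⟨_, corner t ht, by constructor <;> simp⟩
        · exact ⟨_, last, by constructor <;> simp⟩
      · obtain ⟨-, h2, h3⟩ := lower _ hpS
        rcases ht.lt_or_eq with ht | rfl
        · have := h3 t ht
          simp only at this
          omega
        · simp only at h2
          omega)
    (fun x hx => by
      rw [hα0] at hx
      exact kill_d x (X.W_le_sub (fun p hp => zero_mem_down_stair _ _ hp) hx))
    (fun t ht x hxW hxA => kill_d x
      (X.mem_sub_of_le (p := (cornerW a (t + 1), cornerA τ a t)) (down_of_mem _ (corner t ht))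
        hxW hxA))
    (fun x hxW hxA => kill_d x
      (X.mem_sub_of_le (p := (cornerW a (r + 1) - 1, cornerA τ a r)) (down_of_mem _ last) hxW hxA))
  exact ⟨φ, ψ, by rw [hφ z (by rw [hα0]; exact hz.W), hΦz], hc⟩

end Extraction

section Homogeneous

variable {π : ℤ → C →+ C} {α β : ℕ → ℤ} {r : ℕ}

/-- The homogeneous parts of a string, in alternating gradings, form a string. -/
theorem IsProjection.isString (hπ : X.IsProjection π) (m : ℤ) {q y : ℕ → C}
    (h : IsString X.d.toAddMonoidHom X.W X.A α β r q y) :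
    IsString X.d.toAddMonoidHom X.W X.A α β r (fun t => π m (q t)) (fun t => π (m + 1) (y t)) := by
  have dq : ∀ x, X.d.toAddMonoidHom (π m x) = π (m - 1) (X.d x) := fun x => by
    rw [hπ.d_comm, sub_add_cancel]; rfl
  have dy : ∀ x, X.d.toAddMonoidHom (π (m + 1) x) = π m (X.d x) := fun x => (hπ.d_comm m x).symm
  refine ⟨fun t ht => hπ.mem_W _ _ _ (h.q_W t ht), fun t ht => hπ.mem_A _ _ _ (h.q_A t ht),
    fun t ht => hπ.mem_W _ _ _ (h.y_W t ht), fun t ht => hπ.mem_A _ _ _ (h.y_A t ht),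
    fun t ht => ?_, fun t ht => ?_, fun t ht => ?_, fun t ht => ?_⟩
  · rw [dq]; exact hπ.mem_W _ _ _ (h.d_q_W t ht)
  · rw [dq]; exact hπ.mem_A _ _ _ (h.d_q_A t ht)
  · rw [dy, ← map_sub]; exact hπ.mem_A _ _ _ (h.d_y_A t ht)
  · rw [dy, ← map_sub]; exact hπ.mem_W _ _ _ (h.d_y_W t ht)

/-- The homogeneous parts of a costring, in alternating gradings, form a costring. -/
theorem IsProjection.isCostring (hπ : X.IsProjection π) (m : ℤ) {φ ψ : ℕ → C →+ ZMod 2}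
    (h : IsCostring X.d.toAddMonoidHom X.W X.A α β r φ ψ) :
    IsCostring X.d.toAddMonoidHom X.W X.A α β r (fun t => (φ t).comp (π m))
      (fun t => (ψ t).comp (π (m + 1))) := by
  have dy : ∀ x, π m (X.d.toAddMonoidHom x) = X.d.toAddMonoidHom (π (m + 1) x) :=
    fun x => hπ.d_comm m x
  refine ⟨fun t ht x hx => h.φ_W t ht _ (hπ.mem_W _ _ _ hx),
    fun t ht x hx => h.φ_A t ht _ (hπ.mem_A _ _ _ hx),
    fun t ht x hx => h.ψ_W t ht _ (hπ.mem_W _ _ _ hx),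
    fun t ht x hx => h.ψ_A t ht _ (hπ.mem_A _ _ _ hx),
    fun t ht x hx => ?_, fun t ht x hx => ?_, fun x hx => ?_⟩
  · rw [AddMonoidHom.comp_apply, dy]; exact h.φ_d_A t ht _ (hπ.mem_A _ _ _ hx)
  · rw [AddMonoidHom.comp_apply, dy]; exact h.φ_d_W t ht _ (hπ.mem_W _ _ _ hx)
  · rw [AddMonoidHom.comp_apply, dy]; exact h.φ_zero_d _ (hπ.mem_W _ _ _ hx)

end Homogeneous

end BifilteredComplex

section Pairing

variable {V : Type*} [AddCommGroup V] {d : V →+ V} {W A : ℤ → AddSubgroup V} {α β : ℕ → ℤ}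
  {r r' : ℕ} {q y : ℕ → V} {φ ψ : ℕ → V →+ ZMod 2}

theorem IsCostring.φ_q_of_ne (hW : Monotone W) (hA : Monotone A) (hα : StrictMono α)
    (hβ : StrictAnti β) (hs : IsString d W A α β r q y) (hc : IsCostring d W A α β r' φ ψ)
    {s t : ℕ} (hs' : s ≤ r') (ht : t ≤ r) (hst : t ≠ s) : φ s (q t) = 0 := by
  rcases hst.lt_or_gt with h | h
  · exact hc.φ_W s hs' _ (hW (by have := hα h; omega) (hs.q_W t ht))
  · exact hc.φ_A s hs' _ (hA (by have := hβ h; omega) (hs.q_A t ht))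

theorem IsCostring.ψ_y_of_ne (hW : Monotone W) (hA : Monotone A) (hα : StrictMono α)
    (hβ : StrictAnti β) (hs : IsString d W A α β r q y) (hc : IsCostring d W A α β r' φ ψ)
    {s t : ℕ} (hs' : s ≤ r') (ht : t < r) (hst : t ≠ s) : ψ s (y t) = 0 := by
  rcases hst.lt_or_gt with h | h
  · exact hc.ψ_W s hs' _ (hW (by have := hα (Nat.add_lt_add_right h 1); omega) (hs.y_W t ht))
  · exact hc.ψ_A s hs' _ (hA (by have := hβ h; omega) (hs.y_A t ht))

theorem IsCostring.ψ_y_eq (hs : IsString d W A α β r q y) (hc : IsCostring d W A α β r' φ ψ)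
    {t : ℕ} (ht : t < r) (ht' : t ≤ r') : ψ t (y t) = φ t (q t) := by
  rw [← hc.φ_d_A t ht' _ (hs.y_A t ht), ← sub_eq_zero, ← map_sub]
  exact hc.φ_A t ht' _ (hs.d_y_A t ht)

theorem IsCostring.φ_q_succ (hs : IsString d W A α β r q y) (hc : IsCostring d W A α β r' φ ψ)
    {t : ℕ} (ht : t < r) (ht' : t < r') : φ (t + 1) (q (t + 1)) = ψ t (y t) := by
  rw [← hc.φ_d_W t ht' _ (hs.y_W t ht), eq_comm, ← sub_eq_zero, ← map_sub]
  exact hc.φ_W (t + 1) ht' _ (hs.d_y_W t ht)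

theorem IsCostring.φ_q_self (hs : IsString d W A α β r q y) (hc : IsCostring d W A α β r' φ ψ)
    (h0 : φ 0 (q 0) = 1) {t : ℕ} (ht : t ≤ r) (ht' : t ≤ r') : φ t (q t) = 1 := by
  induction t with
  | zero => exact h0
  | succ t ih =>
    rw [hc.φ_q_succ hs ht ht', hc.ψ_y_eq hs ht (by omega), ih (by omega) (by omega)]

end Pairing

/-! ### From zigzags to a locally simplified basis -/

namespace BifilteredComplex

theorem stair_succ_zero (τ : ℤ) (a : ℕ → ℕ) (k : ℕ) :
    stair τ a (k + 1) 0 = stair τ a k (a (k + 1)) := by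
  rw [stair, Set.union_eq_left]
  intro p hp
  split_ifs at hp <;> simp only [Set.mem_ofPred_eq] at hp <;> omega

theorem stair_congr {τ : ℤ} {a a' : ℕ → ℕ} {k : ℕ} (h : ∀ i, 1 ≤ i → i ≤ k → a i = a' i) (s : ℕ) :
    stair τ a k s = stair τ a' k s := by
  induction k generalizing s with
  | zero => rfl
  | succ k ih =>
    have ho : oddSum a (k + 1) = oddSum a' (k + 1) := Finset.sum_congr rfl fun i hi => by
      have := Finset.mem_Icc.1 (Finset.mem_filter.1 hi).1
      exact h i this.1 this.2
    have he : evenSum a (k + 1) = evenSum a' (k + 1) := Finset.sum_congr rfl fun i hi => by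
      have := Finset.mem_Icc.1 (Finset.mem_filter.1 hi).1
      exact h i this.1 this.2
    rw [stair, stair, ih (fun i h1 h2 => h i h1 (by omega)), h (k + 1) (by omega) le_rfl, ho, he]

/-- The sequence `f 0, g 0, f 1, g 1, …`. -/
def interleave {β : Type*} (f g : ℕ → β) (i : ℕ) : β := if Even i then f (i / 2) else g (i / 2)

theorem interleave_even {β : Type*} (f g : ℕ → β) (t : ℕ) : interleave f g (2 * t) = f t := by
  rw [interleave, if_pos (even_two_mul t), Nat.mul_div_cancel_left t two_pos]

theorem interleave_odd {β : Type*} (f g : ℕ → β) (t : ℕ) : interleave f g (2 * t + 1) = g t := by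
  rw [interleave, if_neg (not_even_two_mul_succ t), show (2 * t + 1) / 2 = t by omega]

theorem exists_eq_two_mul_or (i : ℕ) : ∃ t, i = 2 * t ∨ i = 2 * t + 1 := ⟨i / 2, by omega⟩

theorem two_mul_lt_of_lt_or_odd {t n : ℕ} (h : 2 * t ≤ n) (h' : 2 * t < n ∨ Odd n) : 2 * t < n := by
  rcases h' with h' | ⟨s, rfl⟩ <;> omega

theorem two_mul_succ_lt_of_lt_or_even {t n : ℕ} (h : 2 * t + 1 ≤ n) (h' : 2 * t + 1 < n ∨ Even n) :
    2 * t + 1 < n := by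
  rcases h' with h' | ⟨s, rfl⟩ <;> omega

variable {C : Type*} [AddCommGroup C] [Module LaurentF2 C] {X : BifilteredComplex C}

/-- A homogeneous string and a homogeneous costring that pair to `1` yield a locally simplified
basis. -/
theorem exists_isLocallySimplified_of_isString {a : ℕ → ℕ} (ha : ∀ i, 1 ≤ i → 1 ≤ a i)
    {τ m₀ : ℤ} {n : ℕ}
    {q y : ℕ → C} {φ ψ : ℕ → C →+ ZMod 2}
    (hs : IsString X.d.toAddMonoidHom X.W X.A (cornerW a) (cornerA τ a) ((n + 1) / 2) q y)
    (hc : IsCostring X.d.toAddMonoidHom X.W X.A (cornerW a) (cornerA τ a) (n / 2) φ ψ)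
    (hq : ∀ t, q t ∈ X.M m₀) (hy : ∀ t, y t ∈ X.M (m₀ + 1))
    (hφ : ∀ t, ∀ k ≠ m₀, ∀ z ∈ X.M k, φ t z = 0) (hψ : ∀ t, ∀ k ≠ m₀ + 1, ∀ z ∈ X.M k, ψ t z = 0)
    (h0 : φ 0 (q 0) = 1) :
    ∃ (N : ℕ) (b : Module.Basis (Fin N) LaurentF2 C) (w al m : Fin N → ℤ) (e : ℕ → Fin N),
      X.IsFilteredBasis b w al m ∧ X.IsLocallySimplified b w al n a e := by
  have hα := cornerW_strictMono ha
  have hβ := cornerA_strictAnti (τ := τ) ha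
  set α := cornerW a with hαdef
  set β := cornerA τ a with hβdef
  -- the `i`-th element `x i` and functional `χ i` both have level `(o i, v i)` and grading `μ i`
  let x : ℕ → C := interleave q y
  let χ : ℕ → C →+ ZMod 2 := interleave φ ψ
  let o : ℕ → ℤ := interleave α fun t => α (t + 1)
  let v : ℕ → ℤ := interleave β β
  let μ : ℕ → ℤ := interleave (fun _ => m₀) fun _ => m₀ + 1
  have xe : ∀ t, x (2 * t) = q t := interleave_even q y
  have xo : ∀ t, x (2 * t + 1) = y t := interleave_odd q y
  have χe : ∀ t, χ (2 * t) = φ t := interleave_even φ ψ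
  have χo : ∀ t, χ (2 * t + 1) = ψ t := interleave_odd φ ψ
  have oe : ∀ t, o (2 * t) = α t := interleave_even _ _
  have oo : ∀ t, o (2 * t + 1) = α (t + 1) := interleave_odd _ _
  have ve : ∀ t, v (2 * t) = β t := interleave_even _ _
  have vo : ∀ t, v (2 * t + 1) = β t := interleave_odd _ _
  have μe : ∀ t, μ (2 * t) = m₀ := interleave_even _ _
  have μo : ∀ t, μ (2 * t + 1) = m₀ + 1 := interleave_odd _ _
  have hx : ∀ i ≤ n, X.HasLevel (x i) (o i) (v i) (μ i) := by
    intro i hi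
    obtain ⟨t, rfl | rfl⟩ := exists_eq_two_mul_or i
    · rw [xe, oe, ve, μe]
      exact ⟨hs.q_W t (by omega), hs.q_A t (by omega), hq t⟩
    · rw [xo, oo, vo, μo]
      exact ⟨hs.y_W t (by omega), hs.y_A t (by omega), hy t⟩
  have χW : ∀ i ≤ n, ∀ z ∈ X.W (o i - 1), χ i z = 0 := by
    intro i hi
    obtain ⟨t, rfl | rfl⟩ := exists_eq_two_mul_or i
    · rw [χe, oe]; exact hc.φ_W t (by omega)
    · rw [χo, oo]; exact hc.ψ_W t (by omega)
  have χA : ∀ i ≤ n, ∀ z ∈ X.A (v i - 1), χ i z = 0 := by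
    intro i hi
    obtain ⟨t, rfl | rfl⟩ := exists_eq_two_mul_or i
    · rw [χe, ve]; exact hc.φ_A t (by omega)
    · rw [χo, vo]; exact hc.ψ_A t (by omega)
  have χM : ∀ i, ∀ k ≠ μ i, ∀ z ∈ X.M k, χ i z = 0 := by
    intro i
    obtain ⟨t, rfl | rfl⟩ := exists_eq_two_mul_or i
    · rw [χe, μe]; exact hφ t
    · rw [χo, μo]; exact hψ t
  choose Φ hΦ using fun i => X.exists_linearMap_coeff (m₀ := μ i) (φ := χ i) (χM i)
  have hco : ∀ i ≤ n, X.HasColevel (Φ i) (o i) (v i) (μ i) := by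
    refine fun i hi => ⟨fun s z hz k hk => ?_, fun s z hz k hk => ?_, fun s z hz k hk => ?_⟩ <;>
      rw [hΦ] at hk <;> by_contra hne <;> refine hk ?_
    · exact χW i hi _ (X.W_mono (by omega) (X.T_smul_mem_W hz (-k)))
    · exact χA i hi _ (X.A_mono (by omega) (X.T_smul_mem_A hz (-k)))
    · exact χM i _ (by omega) _ (X.T_smul_mem_M hz (-k))
  have hδ : ∀ i ≤ n, ∀ j ≤ n, Φ i (x j) = if j = i then 1 else 0 := by
    intro i hi j hj
    ext k
    have hR : (if j = i then (1 : LaurentF2) else 0).coeff k = if j = i ∧ k = 0 then 1 else 0 := by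
      by_cases hji : j = i
      · rw [if_pos hji, ← LaurentPolynomial.T_zero, LaurentPolynomial.T_apply]
        simp [hji, eq_comm]
      · simp [hji]
    rw [hΦ, hR]
    have hM := X.T_smul_mem_M (hx j hj).M (-k)
    by_cases hμ : μ j - 2 * -k = μ i
    · obtain ⟨s, rfl | rfl⟩ := exists_eq_two_mul_or i <;>
        obtain ⟨t, rfl | rfl⟩ := exists_eq_two_mul_or j <;>
        simp only [μe, μo] at hμ <;> first | omega | skip
      · obtain rfl : k = 0 := by omega
        rw [neg_zero, LaurentPolynomial.T_zero, one_smul, χe, xe]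
        by_cases hts : t = s
        · subst hts
          rw [hc.φ_q_self hs h0 (by omega) (by omega)]; simp
        · rw [hc.φ_q_of_ne X.W_mono X.A_mono hα hβ hs (by omega) (by omega) hts]; simp [hts]
      · obtain rfl : k = 0 := by omega
        rw [neg_zero, LaurentPolynomial.T_zero, one_smul, χo, xo]
        by_cases hts : t = s
        · subst hts
          rw [hc.ψ_y_eq hs (by omega) (by omega), hc.φ_q_self hs h0 (by omega) (by omega)]; simp
        · rw [hc.ψ_y_of_ne X.W_mono X.A_mono hα hβ hs (by omega) (by omega) hts]; simp [hts]
    · rw [χM i _ hμ _ hM, if_neg]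
      rintro ⟨rfl, rfl⟩
      exact hμ (by ring)
  obtain ⟨N, b, w, al, m, e, hb, hinj, he, hcoord⟩ := exists_isFilteredBasis_dual hx hco hδ
  have hbe : ∀ i ≤ n, b (e i) = x i := fun i hi => (he i hi).1
  have hwe : ∀ i ≤ n, w (e i) = o i := fun i hi => (he i hi).2.1
  have hae : ∀ i ≤ n, al (e i) = v i := fun i hi => (he i hi).2.2
  -- the coefficient of an arrow into `e i` is a value of `χ i ∘ d`
  have into : ∀ i ≤ n, ∀ p k, (b.repr (X.d (b p)) (e i)).coeff k =
      χ i (X.d ((LaurentPolynomial.T (-k) : LaurentF2) • b p)) := by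
    intro i hi p k
    rw [hcoord i hi, hΦ, LinearMap.map_smul]
  -- `χ i` is the constant coefficient of the coordinate at `e i`
  have coef : ∀ i ≤ n, ∀ p k, χ i ((LaurentPolynomial.T (-k) : LaurentF2) • b p) ≠ 0 →
      p = e i ∧ k = 0 := by
    intro i hi p k h
    rw [← hΦ, ← hcoord i hi, Module.Basis.repr_self, Finsupp.single_apply] at h
    by_cases hp : p = e i
    · rw [if_pos hp, ← LaurentPolynomial.T_zero, LaurentPolynomial.T_apply] at h
      exact ⟨hp, (ite_ne_right_iff.1 h).1.symm⟩
    · rw [if_neg hp] at h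
      exact absurd rfl h
  have coefx : ∀ i ≤ n, ∀ p k, (b.repr (x i) p).coeff k ≠ 0 → p = e i ∧ k = 0 := by
    intro i hi p k h
    rw [← hbe i hi, Module.Basis.repr_self, Finsupp.single_apply] at h
    by_cases hp : e i = p
    · rw [if_pos hp, ← LaurentPolynomial.T_zero, LaurentPolynomial.T_apply] at h
      exact ⟨hp.symm, (ite_ne_right_iff.1 h).1.symm⟩
    · rw [if_neg hp] at h
      exact absurd rfl h
  have levA : ∀ p k, (LaurentPolynomial.T (-k) : LaurentF2) • b p ∈ X.A (al p + k) := fun p k => by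
    have := X.T_smul_mem_A (hasLevel_basis hb p).A (-k)
    rwa [sub_neg_eq_add] at this
  have levW : ∀ p k, (LaurentPolynomial.T (-k) : LaurentF2) • b p ∈ X.W (w p + k) := fun p k => by
    have := X.T_smul_mem_W (hasLevel_basis hb p).W (-k)
    rwa [sub_neg_eq_add] at this
  -- terms of lower level do not contribute to horizontal or vertical arrows
  have lowA : ∀ c c' j p k, c - c' ∈ X.A (j - 1) → al p - k = j →
      (b.repr c p).coeff k = (b.repr c' p).coeff k := by
    intro c c' j p k h hj
    by_contra hne
    have := hb.mem_A.1 h p k (by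
      rw [map_sub, Finsupp.sub_apply, AddMonoidAlgebra.coeff_sub, Finsupp.sub_apply]
      exact sub_ne_zero.2 hne)
    omega
  have lowW : ∀ c c' j p k, c - c' ∈ X.W (j - 1) → w p - k = j →
      (b.repr c p).coeff k = (b.repr c' p).coeff k := by
    intro c c' j p k h hj
    by_contra hne
    have := hb.mem_W.1 h p k (by
      rw [map_sub, Finsupp.sub_apply, AddMonoidAlgebra.coeff_sub, Finsupp.sub_apply]
      exact sub_ne_zero.2 hne)
    omega
  have one : ∀ i ≤ n, (b.repr (x i) (e i)).coeff 0 = 1 := fun i hi => by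
    rw [← hbe i hi, Module.Basis.repr_self, Finsupp.single_eq_same, ← LaurentPolynomial.T_zero,
      LaurentPolynomial.T_apply, if_pos rfl]
  refine ⟨N, b, w, al, m, e, hb, hinj, ?_, ?_, ?_, ?_⟩
  · rintro i - hi ⟨t, rfl⟩
    rw [Nat.add_sub_cancel]
    have hal : al (e (2 * t)) - 0 = al (e (2 * t + 1)) := by
      rw [hae _ (by omega), hae _ hi, ve, vo, sub_zero]
    refine ⟨⟨?_, hal⟩, ?_⟩
    · rw [Arrow, hbe _ hi, xo, lowA (X.d (y t)) _ _ _ _ (hs.d_y_A t (by omega)), ← xe,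
        one _ (by omega)]
      · exact one_ne_zero
      · rw [hae _ (by omega), ve, sub_zero]
    · rw [hwe _ hi, hwe _ (by omega), oe, oo, hαdef, cornerW_succ]
      ring
  · rintro i hi0 hi ⟨t, rfl⟩
    obtain ⟨t, rfl⟩ : ∃ s, t = s + 1 := ⟨t - 1, by omega⟩
    rw [show t + 1 + (t + 1) = 2 * (t + 1) by ring] at hi ⊢
    rw [show 2 * (t + 1) - 1 = 2 * t + 1 by omega]
    have hw : w (e (2 * (t + 1))) - 0 = w (e (2 * t + 1)) := by
      rw [hwe _ hi, hwe _ (by omega), oe, oo, sub_zero]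
    refine ⟨⟨?_, hw⟩, ?_⟩
    · rw [Arrow, hbe _ (by omega), xo, lowW (X.d (y t)) _ _ _ _ (hs.d_y_W t (by omega)), ← xe,
        one _ hi]
      · exact one_ne_zero
      · rw [hwe _ hi, oe, sub_zero]
    · rw [hae _ hi, hae _ (by omega), ve, vo, hβdef, cornerA_succ]
      ring_nf
  · rintro i hi hin p p' k (rfl | rfl) ⟨harr, hal⟩
    · rw [Arrow, hbe i hi] at harr
      rw [hae i hi] at hal
      obtain ⟨t, rfl | rfl⟩ := exists_eq_two_mul_or i
      · have hin : 2 * t < n := two_mul_lt_of_lt_or_odd hi hin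
        rw [xe, lowA _ 0 (β t) _ _ (by
          rw [sub_zero]; exact hs.d_q_A t (by omega)) (by rw [hal, ve])] at harr
        simp at harr
      · rw [xo, lowA (X.d (y t)) _ _ _ _ (hs.d_y_A t (by omega)) (by rw [hal, vo]), ← xe] at harr
        obtain ⟨rfl, rfl⟩ := coefx (2 * t) (by omega) _ _ harr
        exact ⟨rfl, 2 * t + 1, by omega, hi, odd_two_mul_succ t, rfl, rfl⟩
    · rw [Arrow, into i hi] at harr
      have hlev := levA p k
      rw [← hal, sub_add_cancel, hae i hi] at hlev
      obtain ⟨t, rfl | rfl⟩ := exists_eq_two_mul_or i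
      · have hin : 2 * t < n := two_mul_lt_of_lt_or_odd hi hin
        rw [ve] at hlev
        rw [χe] at harr
        have := hc.φ_d_A t (by omega) _ hlev
        rw [LinearMap.toAddMonoidHom_coe] at this
        rw [this, ← χo] at harr
        obtain ⟨rfl, rfl⟩ := coef (2 * t + 1) (by omega) _ _ harr
        exact ⟨rfl, 2 * t + 1, by omega, hin, odd_two_mul_succ t, rfl, rfl⟩
      · rw [vo] at hlev
        rw [χo] at harr
        have := hc.φ_d_A t (by omega) _ (X.d_A _ _ hlev)
        rw [← this, LinearMap.toAddMonoidHom_coe, X.d_d, map_zero] at harr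
        exact absurd rfl harr
  · rintro i hi hin p p' k (rfl | rfl) ⟨harr, hw⟩
    · rw [Arrow, hbe i hi] at harr
      rw [hwe i hi] at hw
      obtain ⟨t, rfl | rfl⟩ := exists_eq_two_mul_or i
      · rw [xe, lowW _ 0 (α t) _ _ (by
          rw [sub_zero]; exact hs.d_q_W t (by omega)) (by rw [hw, oe])] at harr
        simp at harr
      · have hin : 2 * t + 1 < n := two_mul_succ_lt_of_lt_or_even hi hin
        rw [xo, lowW (X.d (y t)) _ _ _ _ (hs.d_y_W t (by omega)) (by rw [hw, oo]), ← xe] at harr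
        obtain ⟨rfl, rfl⟩ := coefx (2 * (t + 1)) (by omega) _ _ harr
        exact ⟨rfl, 2 * (t + 1), by omega, by omega, even_two_mul _, rfl, rfl⟩
    · rw [Arrow, into i hi] at harr
      have hlev := levW p k
      rw [← hw, sub_add_cancel, hwe i hi] at hlev
      obtain ⟨t, rfl | rfl⟩ := exists_eq_two_mul_or i
      · rw [oe] at hlev
        rw [χe] at harr
        cases t with
        | zero => exact absurd (hc.φ_zero_d _ hlev) harr
        | succ t =>
          have := hc.φ_d_W t (by omega) _ hlev
          rw [LinearMap.toAddMonoidHom_coe] at this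
          rw [this, ← χo] at harr
          obtain ⟨rfl, rfl⟩ := coef (2 * t + 1) (by omega) _ _ harr
          exact ⟨rfl, 2 * (t + 1), by omega, hi, even_two_mul _, rfl, rfl⟩
      · have hin : 2 * t + 1 < n := two_mul_succ_lt_of_lt_or_even hi hin
        rw [oo] at hlev
        rw [χo] at harr
        have := hc.φ_d_W t (by omega) _ (X.d_W _ _ hlev)
        rw [← this, LinearMap.toAddMonoidHom_coe, X.d_d, map_zero] at harr
        exact absurd rfl harr

end BifilteredComplex

/-! ### The invariants and the staircases they define -/

namespace BifilteredComplex

variable {C : Type*} [AddCommGroup C] [Module LaurentF2 C] {X : BifilteredComplex C}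

section Invariants

variable {n : ℕ} {a : ℕ → ℕ} {z : C} {m₀ : ℤ}

theorem IsColumnGenerator.stairMap_eq_zero_iff (hz : X.IsColumnGenerator z m₀) (k s : ℕ) :
    X.stairMap a k s = 0 ↔ z ∈ X.nullGroup (stair X.tau a k s) :=
  hz.homologyMap_eq_zero_iff _

theorem IsColumnGenerator.isLeast_of_even (hz : X.IsColumnGenerator z m₀) (ha : X.IsAPlus n a)
    {k : ℕ} (hk : k < n) (hk' : Even k) :
    IsLeast {s | z ∈ X.nullGroup (stair X.tau a k s)} (a (k + 1)) := by
  simpa only [hz.stairMap_eq_zero_iff] using (ha.2.2.1 k hk).1 hk'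

theorem IsColumnGenerator.isLeast_of_odd (hz : X.IsColumnGenerator z m₀) (ha : X.IsAPlus n a)
    {k : ℕ} (hk : k < n) (hk' : Odd k) :
    IsLeast {s | z ∉ X.nullGroup (stair X.tau a k s)} (a (k + 1)) := by
  simpa only [ne_eq, hz.stairMap_eq_zero_iff] using (ha.2.2.1 k hk).2 hk'

/-- Extending a staircase by a segment of length zero does not change it, while consecutive
invariants are defined by opposite conditions; hence the invariants are positive. -/
theorem IsColumnGenerator.one_le (hz : X.IsColumnGenerator z m₀) (ha : X.IsAPlus n a) {k : ℕ}
    (hk : k < n) : 1 ≤ a (k + 1) := by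
  by_contra! h0
  have h0 : a (k + 1) = 0 := by omega
  cases k with
  | zero =>
    have h1 := (hz.isLeast_of_even ha hk Even.zero).1
    rw [h0] at h1
    exact hz.stairMap_zero_ne a ((hz.stairMap_eq_zero_iff 0 0).2 h1)
  | succ k =>
    rcases Nat.even_or_odd k with hk' | hk'
    · have h1 := (hz.isLeast_of_odd ha hk hk'.add_one).1
      rw [h0, Set.mem_ofPred_eq, stair_succ_zero] at h1
      exact h1 (hz.isLeast_of_even ha (by omega) hk').1
    · have h1 := (hz.isLeast_of_even ha hk hk'.add_one).1
      rw [h0, Set.mem_ofPred_eq, stair_succ_zero] at h1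
      exact (hz.isLeast_of_odd ha (by omega) hk').1 h1

end Invariants

/-- Only the rank of the homology of the column `{i = 0}` enters. -/
theorem IsAPlus.exists_isLocallySimplified {n : ℕ} {a : ℕ → ℕ} (ha : X.IsAPlus n a)
    (hX : Nonempty (X.Homology (column 0) ≃+ ZMod 2)) :
    ∃ (N : ℕ) (b : Module.Basis (Fin N) LaurentF2 C) (w al m : Fin N → ℤ) (e : ℕ → Fin N),
      X.IsFilteredBasis b w al m ∧ X.IsLocallySimplified b w al n a e := by
  obtain ⟨z, m₀, hz⟩ := X.exists_isColumnGenerator hX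
  have hn := ha.2.1
  -- the values beyond `a n` play no role, and are set to `1` to make all the steps positive
  let a' : ℕ → ℕ := fun i => if i ≤ n then a i else 1
  have haa' : ∀ i ≤ n, a i = a' i := fun i hi => (if_pos hi).symm
  have ha'1 : ∀ i > n, a' i = 1 := fun i hi => if_neg (by omega)
  have hpos : ∀ i, 1 ≤ i → 1 ≤ a' i := by
    intro i hi
    by_cases hin : i ≤ n
    · obtain ⟨k, rfl⟩ : ∃ k, i = k + 1 := ⟨i - 1, by omega⟩
      rw [← haa' _ hin]
      exact hz.one_le ha hin
    · rw [ha'1 i (by omega)]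
  have hstair : ∀ k ≤ n, ∀ s, stair X.tau a k s = stair X.tau a' k s := fun k hk s =>
    stair_congr (fun i _ hi => haa' i (by omega)) s
  -- for odd `n` the staircase `S(a₁, …, aₙ)` is regarded as `S(a₁, …, aₙ, a' (n + 1) - 1)`
  have htriv : z ∈ X.nullGroup (stair X.tau a' (2 * ((n + 1) / 2 - 1) + 1)
      (a' (2 * ((n + 1) / 2 - 1) + 2) - 1)) := by
    obtain ⟨t, rfl | rfl⟩ := exists_eq_two_mul_or n
    · obtain ⟨t, rfl⟩ : ∃ s, t = s + 1 := ⟨t - 1, by omega⟩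
      rw [show (2 * (t + 1) + 1) / 2 - 1 = t by omega, ← hstair _ (by omega), ← haa' _ (by omega)]
      have h1 : IsLeast _ (a (2 * t + 2)) :=
        hz.isLeast_of_odd ha (show 2 * t + 1 < 2 * (t + 1) by omega) (odd_two_mul_succ t)
      have h2 : 1 ≤ a (2 * t + 2) := hz.one_le ha (show 2 * t + 1 < 2 * (t + 1) by omega)
      by_contra h3
      have := h1.2 h3
      omega
    · rw [show (2 * t + 1 + 1) / 2 - 1 = t by omega, ha'1 (2 * t + 2) (by omega), Nat.sub_self,
        stair_succ_zero, ← hstair _ (by omega), ← haa' _ le_rfl]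
      exact (hz.isLeast_of_even ha (show 2 * t < 2 * t + 1 by omega) (even_two_mul t)).1
  -- for even `n` the staircase `S(a₁, …, aₙ)` is regarded as `S(a₁, …, aₙ, a' (n + 1) - 1)`
  have hnontriv : z ∉ X.nullGroup (stair X.tau a' (2 * (n / 2)) (a' (2 * (n / 2) + 1) - 1)) := by
    obtain ⟨t, rfl | rfl⟩ := exists_eq_two_mul_or n
    · obtain ⟨t, rfl⟩ : ∃ s, t = s + 1 := ⟨t - 1, by omega⟩
      rw [show 2 * (t + 1) / 2 = t + 1 by omega, ha'1 (2 * (t + 1) + 1) (by omega), Nat.sub_self,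
        show 2 * (t + 1) = 2 * t + 1 + 1 by ring, stair_succ_zero, ← hstair _ (by omega),
        ← haa' _ (by omega)]
      exact (hz.isLeast_of_odd ha (show 2 * t + 1 < 2 * (t + 1) by omega) (odd_two_mul_succ t)).1
    · rw [show (2 * t + 1) / 2 = t by omega, ← hstair _ (by omega), ← haa' _ le_rfl]
      have h1 := hz.isLeast_of_even ha (show 2 * t < 2 * t + 1 by omega) (even_two_mul t)
      have h2 := hz.one_le ha (show 2 * t < 2 * t + 1 by omega)
      intro h3
      have := h1.2 h3
      omega
  obtain ⟨q, y, Y, u, hY, hu, hq0, hs⟩ := hz.exists_isString hpos htriv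
  obtain ⟨φ, ψ, hφz, hc⟩ := hz.exists_isCostring hpos hnontriv
  rw [show (n + 1) / 2 - 1 + 1 = (n + 1) / 2 by omega] at hs
  obtain ⟨π, hπ⟩ := X.exists_isProjection
  have hα0 := cornerW_zero a'
  have h0 : φ 0 (π m₀ (π m₀ (q 0))) = 1 := by
    rw [hπ.of_mem _ _ (hπ.mem_M _ _), hq0, map_add, map_add, map_add, map_add, hπ.of_mem _ _ hz.M,
      hφz, hπ.d_comm]
    have h1 := hc.φ_zero_d _ (by rw [hα0]; exact hπ.mem_W (m₀ + 1) _ _ hY)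
    have h2 := hc.φ_W 0 (Nat.zero_le _) _ (by rw [hα0]; exact hπ.mem_W m₀ _ _ hu)
    rw [LinearMap.toAddMonoidHom_coe] at h1
    rw [h1, h2, add_zero, add_zero]
  obtain ⟨N, b, w, al, m, e, hb, hsimp⟩ := exists_isLocallySimplified_of_isString hpos
    (hπ.isString m₀ hs) (hπ.isCostring m₀ hc) (fun t => hπ.mem_M _ _) (fun t => hπ.mem_M _ _)
    (fun t k hk x hx => by rw [AddMonoidHom.comp_apply, hπ.of_ne _ k hk x hx, map_zero])
    (fun t k hk x hx => by rw [AddMonoidHom.comp_apply, hπ.of_ne _ k hk x hx, map_zero]) h0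
  refine ⟨N, b, w, al, m, e, hb, hsimp.injOn, fun i h1 h2 h3 => ?_, fun i h1 h2 h3 => ?_,
    hsimp.no_other_horz, hsimp.no_other_vert⟩
  · rw [haa' i h2]
    exact hsimp.horz i h1 h2 h3
  · rw [haa' i h2]
    exact hsimp.vert i h1 h2 h3

end BifilteredComplex

theorem mainTheorem5 {C : Type*} [AddCommGroup C] [Module LaurentF2 C]
    (X : BifilteredComplex C) (hX : X.IsKnotLike)
    (n : ℕ) (a : ℕ → ℕ) (ha : X.IsAPlus n a) :
    ∃ (N : ℕ) (b : Module.Basis (Fin N) LaurentF2 C) (w al m : Fin N → ℤ) (e : ℕ → Fin N),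
      X.IsFilteredBasis b w al m ∧ X.IsLocallySimplified b w al n a e :=
  ha.exists_isLocallySimplified (hX.column_rank_one 0)
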